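/- Let $n,k\ge 0$ be integers, let $S_m$ be the symmetric group on $\{1,\dots,m\}$, and let $J_1=0$ and $J_i=(1\ i)+(2\ i)+\cdots+(i-1\ i)$ be the Jucys–Murphy elements in the group algebras of the symmetric groups. They commute pairwise. Let $h_k(x_1,\dots,x_n)=\sum_{1\le i_1\le\cdots\le i_k\le n}x_{i_1}\cdots x_{i_k}$ be the complete symmetric polynomial ($h_0=1$). For a partition $\lambda=(\lambda_1,\dots,\lambda_l)$ of length $l$, its reduction is $\tilde\lambda=(\lambda_1-1,\dots,\lambda_l-1)$ (with zero parts dropped). This gives a bijection from the partitions $\lambda\vdash n$ to the partitions $\mu$ with $|\mu|+\ell(\mu)\le n$. Let $\mathfrak c_\mu(n)\in\mathbb C[S_n]$ be the sum of all permutations in $S_n$ whose cycle-type $\lambda$ (fixed points counted as parts $1$) satisfies $\tilde\lambda=\mu$. Let $H_n\subset S_{2n}$ be the hyperoctahedral group, i.e. the centralizer of $(1\ 2)(3\ 4)\cdots(2n-1\ 2n)$, and let $P_n=\sum_{\zeta\in H_n}\zeta\in\mathbb C[S_{2n}]$. For $\sigma\in S_{2n}$ let $\Gamma(\sigma)$ be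 the graph on $\{1,\dots,2n\}$ with edges $\{2i-1,2i\}$ and $\{\sigma(2i-1),\sigma(2i)\}$, $1\le i\le n$. If its connected components have $2\rho_1\ge 2\rho_2\ge\cdots$ vertices, then $\rho=(\rho_1,\rho_2,\dots)\vdash n$ is the coset-type of $\sigma$, and $\tilde\rho$ is its reduced coset-type; two permutations have the same coset-type if and only if they lie in the same double coset of $H_n$. Let $\psi_\mu(n)\in\mathbb C[S_{2n}]$ be the sum of all permutations in $S_{2n}$ of reduced coset-type $\mu$. Then there are unique families of complex numbers $F^k_\mu(n)$ and $G^k_\mu(n)$, indexed by the partitions $\mu$ with $|\mu|+\ell(\mu)\le n$, such that $$h_k(J_1,J_2,\dots,J_n)=\sum_{|\mu|+\ell(\mu)\le n}F^k_\mu(n)\,\mathfrak c_\mu(n),\qquad h_k(J_1,J_3,\dots,J_{2n-1})\cdot P_n=\sum_{|\mu|+\ell(\mu)\le n}G^k_\mu(n)\,\psi_\mu(n),$$ and for every partition $\mu\vdash k$ with $k+\ell(\mu)\le n$, $$G^k_\mu(n)=F^k_\mu(n)=\prod_{i=1}^{\ell(\mu)}\mathrm{Cat}_{\mu_i},\qquad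 \mathrm{Cat}_j=\frac1{j+1}\binom{2j}{j}.$$ -/

import Mathlib

open scoped Classical in
/-- The complete homogeneous symmetric polynomial evaluated at `x₀, …, x_{n-1}`:
`h_k(x) = ∑_{i₁ ≤ ⋯ ≤ i_k} x_{i₁} ⋯ x_{i_k}`. It is meant for pairwise commuting elements
of a possibly noncommutative ring. -/
noncomputable def hComplete {A : Type*} [Semiring A] {n : ℕ} (k : ℕ) (x : Fin n → A) : A :=
  ∑ i : Fin k → Fin n with Monotone i, (List.ofFn fun j => x (i j)).prod

/-- Over a commutative ring, `hComplete` is the value of Mathlib's `MvPolynomial.hsymm`. -/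
theorem hComplete_eq_aeval_hsymm {A : Type*} [CommSemiring A] {n : ℕ} (k : ℕ) (x : Fin n → A) :
    hComplete k x = MvPolynomial.aeval x (MvPolynomial.hsymm (Fin n) ℕ k) := by
  classical
  have hprod : ∀ i : Fin k → Fin n,
      (List.ofFn fun j => x (i j)).prod = ((Multiset.ofList (List.ofFn i)).map x).prod := by
    intro i
    rw [Multiset.map_coe, Multiset.prod_coe, List.map_ofFn]
    rfl
  rw [MvPolynomial.hsymm, map_sum, hComplete]
  refine Finset.sum_bij
    (fun i _ => (⟨Multiset.ofList (List.ofFn i), by simp⟩ : Sym (Fin n) k)) ?_ ?_ ?_ ?_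
  · intro i _
    exact Finset.mem_univ _
  · intro i hi j hj hij
    have h : (List.ofFn i).Perm (List.ofFn j) := by
      simpa using congrArg Subtype.val hij
    simp only [Finset.mem_filter, Finset.mem_univ, true_and] at hi hj
    exact List.ofFn_injective (h.eq_of_sortedLE hi.sortedLE_ofFn hj.sortedLE_ofFn)
  · intro s _
    have hl : (s.1.sort (· ≤ ·)).length = k := by simp
    refine ⟨fun j => (s.1.sort (· ≤ ·)).get (j.cast hl.symm), ?_, ?_⟩
    · simp only [Finset.mem_filter, Finset.mem_univ, true_and]
      intro a b hab
      exact (Multiset.pairwise_sort s.1 (· ≤ ·)).sortedLE.monotone_get hab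
    · apply Subtype.ext
      have : (List.ofFn fun j : Fin k => (s.1.sort (· ≤ ·)).get (j.cast hl.symm))
          = s.1.sort (· ≤ ·) := by
        apply List.ext_get
        · simp
        · intro m h₁ h₂
          simp only [List.get_ofFn]
          rfl
      simp only [this]
      exact Multiset.sort_eq _ _
  · intro i _
    rw [hprod, map_multiset_prod, Multiset.map_map]
    congr 1
    refine Multiset.map_congr rfl fun a _ => ?_
    simp

/-- The group algebra `ℂ[S_m]`, where `S_m` acts on `Fin m = {0, …, m - 1}`
(the letter `j` of `{1, …, m}` is `j - 1` here). -/
abbrev SymGroupAlg (m : ℕ) : Type := MonoidAlgebra ℂ (Equiv.Perm (Fin m))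

/-- The element `∑_{σ ∈ S} σ` of `ℂ[S_m]`. -/
noncomputable def permSum {m : ℕ} (S : Finset (Equiv.Perm (Fin m))) : SymGroupAlg m :=
  ∑ σ ∈ S, MonoidAlgebra.single σ 1

/-- The Jucys–Murphy element at the letter `i : Fin m`, i.e. the sum of the transpositions `(j i)`
over all letters `j < i`. With letters `1, …, m` this is `J_{i+1}`. -/
noncomputable def jucysMurphy {m : ℕ} (i : Fin m) : SymGroupAlg m :=
  ∑ j : Fin m with j < i, MonoidAlgebra.single (Equiv.swap j i) 1

theorem jucysMurphy_commute {m : ℕ} (i j : Fin m) : Commute (jucysMurphy i) (jucysMurphy j) := by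
  have key : ∀ i j : Fin m, i < j → Commute (jucysMurphy i) (jucysMurphy j) := by
    intro i j hij
    refine Commute.sum_left _ _ _ fun a ha => ?_
    simp only [Finset.mem_filter, Finset.mem_univ, true_and] at ha
    simp only [Commute, SemiconjBy, jucysMurphy, Finset.mul_sum, Finset.sum_mul,
      MonoidAlgebra.single_mul_single, mul_one]
    refine Finset.sum_equiv (Equiv.swap a i) ?_ ?_
    · intro b
      simp only [Finset.mem_filter, Finset.mem_univ, true_and]
      rw [Equiv.swap_apply_def]
      split_ifs with h₁ h₂
      · subst h₁; exact ⟨fun _ => hij, fun _ => ha.trans hij⟩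
      · subst h₂; exact ⟨fun _ => ha.trans hij, fun _ => hij⟩
      · exact Iff.rfl
    · intro b _
      congr 1
      rw [Equiv.mul_swap_eq_swap_mul,
        Equiv.swap_apply_of_ne_of_ne (ne_of_gt (ha.trans hij)) (ne_of_gt hij)]
  rcases lt_trichotomy i j with h | h | h
  · exact key i j h
  · subst h; exact Commute.refl _
  · exact (key j i h).symm

/-- The letter `2i - 1` of `{1, …, 2n}`, for `i = 1, …, n`. -/
def oddLetter {n : ℕ} (i : Fin n) : Fin (2 * n) := ⟨2 * i, by omega⟩

/-- The letter `2i` of `{1, …, 2n}`, for `i = 1, …, n`. -/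
def evenLetter {n : ℕ} (i : Fin n) : Fin (2 * n) := ⟨2 * i + 1, by omega⟩

/-- The involution `(1 2)(3 4) ⋯ (2n-1 2n)` of `S_{2n}`. -/
def pairFlip (n : ℕ) : Equiv.Perm (Fin (2 * n)) :=
  (List.ofFn fun i : Fin n => Equiv.swap (oddLetter i) (evenLetter i)).prod

/-- The hyperoctahedral group `H_n`, the centralizer of `(1 2)(3 4) ⋯ (2n-1 2n)` in `S_{2n}`. -/
def hyperoctahedral (n : ℕ) : Subgroup (Equiv.Perm (Fin (2 * n))) :=
  Subgroup.centralizer {pairFlip n}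

open scoped Classical in
/-- `P_n`, the sum of all elements of `H_n` in `ℂ[S_{2n}]`. -/
noncomputable def hyperoctahedralSum (n : ℕ) : SymGroupAlg (2 * n) :=
  permSum {ζ : Equiv.Perm (Fin (2 * n)) | ζ ∈ hyperoctahedral n}

/-- The graph `Γ(σ)` on the `2n` letters whose edges are the pairs `{2i-1, 2i}` and
`{σ(2i-1), σ(2i)}`, `1 ≤ i ≤ n`. (A pair that occurs in both families gives one edge here; this
does not affect the connected components.) -/
def cosetGraph {n : ℕ} (σ : Equiv.Perm (Fin (2 * n))) : SimpleGraph (Fin (2 * n)) :=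
  SimpleGraph.fromEdgeSet
    (Set.range (fun i : Fin n => s(oddLetter i, evenLetter i)) ∪
      Set.range (fun i : Fin n => s(σ (oddLetter i), σ (evenLetter i))))

open scoped Classical in
/-- The coset-type of `σ ∈ S_{2n}`, as the multiset of its parts: every connected component
of `Γ(σ)` with `2r` vertices contributes a part `r`. -/
noncomputable def cosetType {n : ℕ} (σ : Equiv.Perm (Fin (2 * n))) : Multiset ℕ :=
  (Finset.univ : Finset (cosetGraph σ).ConnectedComponent).val.map fun c => c.supp.ncard / 2

/-- The reduction `(λ₁ - 1, λ₂ - 1, …)` of a partition, as a multiset of nonzero parts. -/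
def reduction (s : Multiset ℕ) : Multiset ℕ := (s.map fun a => a - 1).filter fun a => a ≠ 0

/-- `c_μ(n)`, the sum of the permutations in `S_n` of reduced cycle-type `μ`. -/
noncomputable def classSum (n : ℕ) {m : ℕ} (μ : m.Partition) : SymGroupAlg n :=
  permSum {σ : Equiv.Perm (Fin n) | reduction σ.partition.parts = μ.parts}

/-- `ψ_μ(n)`, the sum of the permutations in `S_{2n}` of reduced coset-type `μ`. -/
noncomputable def doubleCosetSum (n : ℕ) {m : ℕ} (μ : m.Partition) : SymGroupAlg (2 * n) :=
  permSum {σ : Equiv.Perm (Fin (2 * n)) | reduction (cosetType σ) = μ.parts}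

/-- The partitions `ν` (of any size) with `|ν| + ℓ(ν) ≤ n`. -/
def ReducedPartition (n : ℕ) : Type :=
  {ν : Σ m : ℕ, m.Partition // ν.1 + ν.2.parts.card ≤ n}

noncomputable instance (n : ℕ) : Fintype (ReducedPartition n) :=
  Fintype.subtype
    (((Finset.range (n + 1)).sigma fun m => (Finset.univ : Finset m.Partition)).filter
      fun ν => ν.1 + ν.2.parts.card ≤ n)
    (by
      intro ν
      simp only [Finset.mem_filter, Finset.mem_sigma, Finset.mem_range, Finset.mem_univ, and_true]
      omega)

/-- `F` is the family of coefficients `F^k_ν(n)` of the class expansion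
`h_k(J_1, J_2, …, J_n) = ∑_ν F^k_ν(n) c_ν(n)`. -/
def IsUnitaryCoeff (n k : ℕ) (F : ReducedPartition n → ℂ) : Prop :=
  hComplete k (fun i : Fin n => jucysMurphy i) = ∑ ν, F ν • classSum n ν.1.2

/-- `G` is the family of coefficients `G^k_ν(n)` of the double coset expansion
`h_k(J_1, J_3, …, J_{2n-1}) P_n = ∑_ν G^k_ν(n) ψ_ν(n)`. -/
def IsOrthogonalCoeff (n k : ℕ) (G : ReducedPartition n → ℂ) : Prop :=
  hComplete k (fun i : Fin n => jucysMurphy (oddLetter i)) * hyperoctahedralSum n =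
    ∑ ν, G ν • doubleCosetSum n ν.1.2

/-!
Both expansions are instances of one counting problem. Left multiplication by the Jucys–Murphy
element at a letter `b` replaces a permutation `σ` by the permutations `(a b) σ` with `a < b`, and
this changes the cycles of a permutation `φ` attached to `σ` (`JucysMurphyModel`). In the first
expansion `φ = σ`. In the second, `φ` is the product of the two fixed point free involutions whose
pairs are the edges of `Γ(σ)`: its cycles come in pairs `{C, C'}`, interchanged by
`(1 2)(3 4) ⋯ (2n-1 2n)`, which correspond to the components of `Γ(σ)`. Thus the coset-type is
the cycle type of `φ` on a half of the letters that contains one cycle of each pair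
(`reduction_cosetType`), and a transposition of two letters of the half acts on `φ` by left
multiplication there. The move by `(a b)` lowers the rank (the sum of the parts of the reduced type)
by one if `a` and `b` lie on a common cycle of `φ`, which it cuts in two, and otherwise does not
lower it.

*Top coefficients.* From
`h_{k+1}(x₁, …, x_{m+1}) = h_{k+1}(x₁, …, x_m) + x_{m+1} h_k(x₁, …, x_{m+1})`
the coefficient of a permutation of rank `k` in degree `k` is the sum of the coefficients, in degree
`k - 1`, of the permutations obtained by cutting the cycle of `φ` through `b` at each of its other
letters, where `b` is the largest of the letters of the Jucys–Murphy elements that `φ` moves. This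
is the recursion of the Catalan numbers
(`catalanWeight_eq_sum_swap_mul`, `JucysMurphyModel.coeff_completeSymm_mul`).

*Existence of the expansions.* The same analysis, easier because exactly one move is possible at
each step, shows that the `k`-th elementary symmetric polynomial gives the sum of all permutations of
rank `k` (`JucysMurphyModel.coeff_elemSymm_mul`). This sum is central, respectively invariant under
the hyperoctahedral group on both sides. The relation `∑ (-1)^i e_i h_{k-i} = 0` transfers the
invariance to the complete symmetric polynomials (`completeSymm_mul_mem`). Invariance means that
coefficients depend on the type only: permutations of equal cycle type are conjugate, and
permutations of equal coset-type lie in one double coset, because an equivariant bijection between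
two halves extends uniquely to one that commutes with `(1 2)(3 4) ⋯ (2n-1 2n)`
(`exists_commute_conj_eq`).
-/

open Equiv Equiv.Perm

/-! ### Cutting and joining cycles by a transposition -/

/-- The reduced cycle type of a permutation: the multiset of the numbers `m - 1`, where `m` runs
over the lengths of the nontrivial cycles. The sum of its parts is the rank of the permutation,
the least number of transpositions of which it is a product. -/
def reducedCycleType {α : Type*} [Fintype α] [DecidableEq α] (f : Perm α) : Multiset ℕ :=
  f.cycleType.map fun m => m - 1

/-- The product of the Catalan numbers indexed by the elements of a multiset. -/
def catalanWeight (s : Multiset ℕ) : ℕ := (s.map catalan).prod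

section Cycles

variable {α : Type*} [DecidableEq α]

theorem disjoint_formPerm {l : List α} {g : Perm α} (h : ∀ x ∈ l, g x = x) :
    Disjoint l.formPerm g := by
  intro x
  by_cases hx : x ∈ l
  · exact Or.inr (h x hx)
  · exact Or.inl (List.formPerm_apply_of_notMem hx)

theorem formPerm_mul_apply_eq_self {l : List α} {g : Perm α} {x : α} (hx : x ∉ l) (hg : g x = x) :
    (l.formPerm * g) x = x := by
  rw [Perm.mul_apply, hg, List.formPerm_apply_of_notMem hx]

/-- A cycle, multiplied on the left by a transposition of two of its letters, falls apart into
two cycles. -/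
theorem formPerm_cons_append_cons (b a : α) (l₁ l₂ : List α) (h : (b :: l₁ ++ a :: l₂).Nodup) :
    (b :: l₁ ++ a :: l₂).formPerm =
      swap b a * ((b :: l₁).formPerm * (a :: l₂).formPerm) := by
  induction l₁ generalizing b with
  | nil => simp [List.formPerm_cons_cons]
  | cons c l₁ ih =>
    have ih' := ih c (by simpa using (List.nodup_cons.1 h).2)
    have hba : b ≠ a := by rintro rfl; simp at h
    have hbc : b ≠ c := by rintro rfl; simp at h
    have hca : a ≠ c := by rintro rfl; simp at h
    have hs : swap b c * swap c a = swap b a * swap b c := by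
      rw [Equiv.mul_swap_eq_swap_mul, Equiv.swap_apply_right,
        Equiv.swap_apply_of_ne_of_ne hba.symm hca]
    simp only [List.cons_append] at ih' ⊢
    rw [List.formPerm_cons_cons, ih', List.formPerm_cons_cons, ← mul_assoc, hs]
    simp only [mul_assoc]

theorem swap_mul_formPerm_append (a b : α) (l₁ l₂ : List α)
    (h : (b :: l₁ ++ a :: l₂).Nodup)
    (g : Perm α) :
    swap a b * ((b :: l₁ ++ a :: l₂).formPerm * g) =
      (b :: l₁).formPerm * ((a :: l₂).formPerm * g) := by
  rw [formPerm_cons_append_cons b a l₁ l₂ h, swap_comm a b]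
  simp [mul_assoc, ← mul_assoc (swap b a) (swap b a)]

variable [Fintype α]

theorem reducedCycleType_mul_of_disjoint {f g : Perm α} (h : Disjoint f g) :
    reducedCycleType (f * g) = reducedCycleType f + reducedCycleType g := by
  simp [reducedCycleType, h.cycleType_mul]

theorem reducedCycleType_formPerm {l : List α} (hl : l.Nodup) :
    reducedCycleType l.formPerm = if 2 ≤ l.length then {l.length - 1} else 0 := by
  split_ifs with h
  · have hs : l.formPerm.support = l.toFinset :=
      List.support_formPerm_of_nodup l hl (by rintro x rfl; simp at h)
    rw [reducedCycleType, (List.isCycle_formPerm hl h).cycleType, hs,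
      List.toFinset_card_of_nodup hl, Multiset.map_singleton]
  · rw [(List.formPerm_eq_one_iff l hl).2 (by omega)]
    simp [reducedCycleType]

theorem sum_reducedCycleType_formPerm {l : List α} (hl : l.Nodup) :
    (reducedCycleType l.formPerm).sum = l.length - 1 := by
  rw [reducedCycleType_formPerm hl]
  split_ifs with h
  · simp
  · simp; omega

theorem catalanWeight_formPerm {l : List α} (hl : l.Nodup) :
    catalanWeight (reducedCycleType l.formPerm) = catalan (l.length - 1) := by
  rw [reducedCycleType_formPerm hl]
  split_ifs with h
  · simp [catalanWeight]
  · simp [catalanWeight, show l.length - 1 = 0 by omega]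

theorem sum_reducedCycleType_formPerm_mul {l : List α} (hl : l.Nodup) {g : Perm α}
    (h : ∀ x ∈ l, g x = x) :
    (reducedCycleType (l.formPerm * g)).sum = l.length - 1 + (reducedCycleType g).sum := by
  rw [reducedCycleType_mul_of_disjoint (disjoint_formPerm h), Multiset.sum_add,
    sum_reducedCycleType_formPerm hl]

theorem catalanWeight_formPerm_mul {l : List α} (hl : l.Nodup) {g : Perm α}
    (h : ∀ x ∈ l, g x = x) :
    catalanWeight (reducedCycleType (l.formPerm * g)) =
      catalan (l.length - 1) * catalanWeight (reducedCycleType g) := by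
  rw [← catalanWeight_formPerm hl, reducedCycleType_mul_of_disjoint (disjoint_formPerm h),
    catalanWeight, Multiset.map_add, Multiset.prod_add]
  rfl

/-- Splitting off the cycle through `b`, written as a list that starts with `b`. -/
theorem exists_formPerm_mul_eq (f : Perm α) (b : α) :
    ∃ (l : List α) (g : Perm α), (b :: l).Nodup ∧ f = (b :: l).formPerm * g ∧
      (∀ x ∈ b :: l, g x = x) ∧ ∀ x, x ∈ b :: l ↔ SameCycle f b x := by
  by_cases hb : f b = b
  · refine ⟨[], f, by simp, by simp, by simpa using hb, fun x => ?_⟩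
    simp only [List.mem_singleton]
    exact ⟨fun h => h ▸ SameCycle.refl f b, fun h => (h.eq_of_left hb).symm⟩
  · have hs : b ∈ f.support := mem_support.2 hb
    have hlen := two_le_length_toList_iff_mem_support.2 hs
    have h0 := toList_getElem_zero f b hs
    obtain ⟨c, l, hl⟩ : ∃ c l, f.toList b = c :: l := by
      cases h : f.toList b with
      | nil => simp [h] at hlen
      | cons c l => exact ⟨c, l, rfl⟩
    have hc : c = b := by simpa [hl] using h0
    subst hc
    refine ⟨l, (f.cycleOf c)⁻¹ * f, hl ▸ nodup_toList f c, ?_, ?_, ?_⟩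
    · rw [← hl, formPerm_toList]; simp
    · intro x hx
      rw [← hl, mem_toList_iff] at hx
      rw [Perm.mul_apply, Perm.inv_eq_iff_eq, hx.1.cycleOf_apply]
    · intro x
      rw [← hl, mem_toList_iff]
      simp [hb]

theorem exists_formPerm_append_mul_eq {f : Perm α} {a b : α} (hab : a ≠ b) (h : SameCycle f b a) :
    ∃ (l₁ l₂ : List α) (g : Perm α), (b :: l₁ ++ a :: l₂).Nodup ∧
      (∀ x ∈ b :: l₁ ++ a :: l₂, g x = x) ∧ f = (b :: l₁ ++ a :: l₂).formPerm * g := by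
  obtain ⟨l, g, hl, hf, hg, hm⟩ := exists_formPerm_mul_eq f b
  have ha : a ∈ l := by simpa [hab] using (hm a).2 h
  obtain ⟨l₁, l₂, rfl⟩ := List.append_of_mem ha
  exact ⟨l₁, l₂, g, hl, hg, hf⟩

theorem rank_and_catalanWeight_formPerm_mul (a b : α) (l₁ l₂ : List α)
    (h : (b :: l₁ ++ a :: l₂).Nodup) (g : Perm α) (hg : ∀ x ∈ b :: l₁ ++ a :: l₂, g x = x) :
    (reducedCycleType ((b :: l₁).formPerm * ((a :: l₂).formPerm * g))).sum =
      l₁.length + (l₂.length + (reducedCycleType g).sum) ∧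
    catalanWeight (reducedCycleType ((b :: l₁).formPerm * ((a :: l₂).formPerm * g))) =
      catalan l₁.length * (catalan l₂.length * catalanWeight (reducedCycleType g)) := by
  obtain ⟨h₁, h₂, h₃⟩ := List.nodup_append'.1 h
  have hg₂ : ∀ x ∈ a :: l₂, g x = x := fun x hx => hg x (List.mem_append_right _ hx)
  have hg₁ : ∀ x ∈ b :: l₁, ((a :: l₂).formPerm * g) x = x := fun x hx =>
    formPerm_mul_apply_eq_self (h₃ hx) (hg x (List.mem_append_left _ hx))
  rw [sum_reducedCycleType_formPerm_mul h₁ hg₁, sum_reducedCycleType_formPerm_mul h₂ hg₂,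
    catalanWeight_formPerm_mul h₁ hg₁, catalanWeight_formPerm_mul h₂ hg₂]
  simp

theorem rank_swap_mul_of_sameCycle {f : Perm α} {a b : α} (hab : a ≠ b) (h : SameCycle f b a) :
    (reducedCycleType (swap a b * f)).sum + 1 = (reducedCycleType f).sum := by
  obtain ⟨l₁, l₂, g, hl, hg, rfl⟩ := exists_formPerm_append_mul_eq hab h
  rw [swap_mul_formPerm_append a b l₁ l₂ hl,
    (rank_and_catalanWeight_formPerm_mul a b l₁ l₂ hl g hg).1,
    sum_reducedCycleType_formPerm_mul hl hg]
  simp; omega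

theorem rank_swap_mul_of_not_sameCycle {f : Perm α} {a b : α} (h : ¬ SameCycle f b a) :
    (reducedCycleType (swap a b * f)).sum = (reducedCycleType f).sum + 1 := by
  obtain ⟨l₁, g, hl₁, hf, hg, hm⟩ := exists_formPerm_mul_eq f b
  obtain ⟨l₂, g', hl₂, hf', hg', hm'⟩ := exists_formPerm_mul_eq g a
  have ha : a ∉ b :: l₁ := fun h' => h ((hm a).1 h')
  have hdis : ∀ x ∈ b :: l₁, x ∉ a :: l₂ := fun x hx hx' =>
    ha (((hm' x).1 hx').eq_of_right (hg x hx) ▸ hx)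
  have hl : (b :: l₁ ++ a :: l₂).Nodup := List.nodup_append'.2 ⟨hl₁, hl₂, fun x => hdis x⟩
  have hg'' : ∀ x ∈ b :: l₁ ++ a :: l₂, g' x = x := by
    intro x hx
    rcases List.mem_append.1 hx with hx | hx
    · have h1 := hg x hx
      rw [hf', Perm.mul_apply] at h1
      apply (a :: l₂).formPerm.injective
      rw [h1, List.formPerm_apply_of_notMem (hdis x hx)]
    · exact hg' x hx
  have hsplit := swap_mul_formPerm_append a b l₁ l₂ hl g'
  have hff : f = (b :: l₁).formPerm * ((a :: l₂).formPerm * g') := by rw [← hf']; exact hf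
  have hsf : swap a b * f = (b :: l₁ ++ a :: l₂).formPerm * g' := by
    rw [hff, ← hsplit]; simp
  rw [hsf, sum_reducedCycleType_formPerm_mul hl hg'', hff,
    (rank_and_catalanWeight_formPerm_mul a b l₁ l₂ hl g' hg'').1]
  simp; omega

theorem rank_le_rank_swap_mul_add_one (f : Perm α) (a b : α) :
    (reducedCycleType f).sum ≤ (reducedCycleType (swap a b * f)).sum + 1 := by
  by_cases hab : a = b
  · subst hab; rw [swap_self, ← Perm.one_def, one_mul]; omega
  by_cases h : SameCycle f b a
  · rw [rank_swap_mul_of_sameCycle hab h]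
  · rw [rank_swap_mul_of_not_sameCycle h]; omega

/-- The Catalan weight of a permutation is the sum of the weights of the permutations that arise
when the cycle through a moved letter `b` is cut at its other letters: this is the Catalan
recursion. -/
theorem catalanWeight_eq_sum_swap_mul
    {f : Perm α} {b : α} (hb : f b ≠ b) :
    catalanWeight (reducedCycleType f) =
      ∑ a with a ≠ b ∧ SameCycle f b a, catalanWeight (reducedCycleType (swap a b * f)) := by
  obtain ⟨l, g, hl, hf, hg, hm⟩ := exists_formPerm_mul_eq f b
  have hbl : b ∉ l := (List.nodup_cons.1 hl).1
  have hS : (Finset.univ.filter fun a => a ≠ b ∧ SameCycle f b a) = l.toFinset := by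
    ext a
    simp only [Finset.mem_filter, Finset.mem_univ, true_and, List.mem_toFinset, ← hm,
      List.mem_cons]
    constructor
    · rintro ⟨h1, h2 | h2⟩
      · exact absurd h2 h1
      · exact h2
    · intro h
      exact ⟨fun h' => hbl (h' ▸ h), Or.inr h⟩
  have hl0 : l ≠ [] := by
    rintro rfl
    apply hb
    rw [hf]
    simpa using hg b (by simp)
  obtain ⟨m, hm'⟩ : ∃ m, l.length = m + 1 :=
    Nat.exists_eq_succ_of_ne_zero (by simpa [List.length_eq_zero_iff] using hl0)
  rw [hS, List.sum_toFinset _ (List.nodup_cons.1 hl).2]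
  have hterm : ∀ i : Fin (m + 1),
      catalanWeight (reducedCycleType (swap (l.get (i.cast hm'.symm)) b * f)) =
        catalan i * catalan (m - i) * catalanWeight (reducedCycleType g) := by
    intro i
    have hi : (i : ℕ) < l.length := by omega
    have hsplit : l = l.take i ++ l[(i : ℕ)] :: l.drop (i + 1) := by
      rw [← List.drop_eq_getElem_cons hi, List.take_append_drop]
    have hget : l.get (i.cast hm'.symm) = l[(i : ℕ)] := rfl
    have hl' : (b :: l.take i ++ l[(i : ℕ)] :: l.drop (i + 1)).Nodup := by
      rw [List.cons_append, ← hsplit]; exact hl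
    have hg' : ∀ x ∈ b :: l.take i ++ l[(i : ℕ)] :: l.drop (i + 1), g x = x := by
      rw [List.cons_append, ← hsplit]; exact hg
    have hf' : f = (b :: l.take i ++ l[(i : ℕ)] :: l.drop (i + 1)).formPerm * g := by
      rw [List.cons_append, ← hsplit]; exact hf
    rw [hget]
    conv_lhs => rw [hf']
    rw [swap_mul_formPerm_append _ b _ _ hl',
      (rank_and_catalanWeight_formPerm_mul _ b _ _ hl' g hg').2,
      ← mul_assoc]
    congr 3
    · simp; omega
    · simp; omega
  have hlist : (l.map fun a => catalanWeight (reducedCycleType (swap a b * f))).sum =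
      ∑ i : Fin (m + 1),
        catalanWeight (reducedCycleType (swap (l.get (i.cast hm'.symm)) b * f)) := by
    conv_lhs => rw [← List.ofFn_get l, List.map_ofFn, List.sum_ofFn]
    exact Fintype.sum_equiv (finCongr hm') _ _ fun i => rfl
  rw [hlist, Finset.sum_congr rfl fun i _ => hterm i, ← Finset.sum_mul, ← catalan_succ, hf,
    catalanWeight_formPerm_mul hl hg]
  simp [hm']

end Cycles

/-! ### Recursions for complete and elementary symmetric polynomials -/

section SymmetricPolynomials

variable {A : Type*}

theorem hComplete_zero [Semiring A] {n : ℕ} (x : Fin n → A) : hComplete 0 x = 1 := by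
  classical
  have h : ∀ i : Fin 0 → Fin n, Monotone i := fun i a => a.elim0
  simp [hComplete, h]

theorem hComplete_succ_of_isEmpty [Semiring A] (k : ℕ) (x : Fin 0 → A) :
    hComplete (k + 1) x = 0 := by
  classical
  simp [hComplete]

theorem Fin.monotone_snoc_last {k m : ℕ} (i : Fin k → Fin (m + 1)) :
    Monotone (Fin.snoc i (Fin.last m) : Fin (k + 1) → Fin (m + 1)) ↔ Monotone i := by
  constructor
  · intro h a b hab
    simpa using h (Fin.castSucc_le_castSucc_iff.2 hab)
  · intro h a b hab
    induction b using Fin.lastCases with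
    | last => simp [Fin.le_last]
    | cast b =>
      induction a using Fin.lastCases with
      | last => exact absurd hab (not_le.2 (Fin.castSucc_lt_last b))
      | cast a => simpa using h (Fin.castSucc_le_castSucc_iff.1 hab)

/-- The recursion for `h_k`: a weakly increasing word either avoids the largest index or ends
with it. -/
theorem hComplete_succ_succ [Semiring A] {m : ℕ} (k : ℕ) (x : Fin (m + 1) → A) :
    hComplete (k + 1) x =
      hComplete (k + 1) (fun i : Fin m => x i.castSucc) + hComplete k x * x (Fin.last m) := by
  classical
  have hlast : ∑ i : Fin (k + 1) → Fin (m + 1) with Monotone i ∧ i (Fin.last k) = Fin.last m,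
      (List.ofFn fun j => x (i j)).prod = hComplete k x * x (Fin.last m) := by
    rw [hComplete, Finset.sum_mul]
    symm
    refine Finset.sum_bij (fun i _ => (Fin.snoc i (Fin.last m) : Fin (k + 1) → Fin (m + 1)))
      ?_ ?_ ?_ ?_
    · intro i hi
      simpa [Fin.monotone_snoc_last] using hi
    · intro i _ j _ h
      exact (Fin.snoc_injective2 h).1
    · intro i hi
      simp only [Finset.mem_filter, Finset.mem_univ, true_and] at hi
      have h : (Fin.snoc (fun j : Fin k => i j.castSucc) (Fin.last m) :
          Fin (k + 1) → Fin (m + 1)) = i := by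
        rw [← hi.2]; exact Fin.snoc_init_self i
      refine ⟨fun j => i j.castSucc, ?_, h⟩
      simp only [Finset.mem_filter, Finset.mem_univ, true_and]
      exact fun a b hab => hi.1 (Fin.castSucc_le_castSucc_iff.2 hab)
    · intro i _
      rw [List.ofFn_succ', List.concat_eq_append, List.prod_append]
      simp
  have hrest : ∑ i : Fin (k + 1) → Fin (m + 1) with Monotone i ∧ ¬ i (Fin.last k) = Fin.last m,
      (List.ofFn fun j => x (i j)).prod = hComplete (k + 1) (fun i : Fin m => x i.castSucc) := by
    rw [hComplete]
    symm
    refine Finset.sum_bij (fun i _ => fun j => (i j).castSucc) ?_ ?_ ?_ ?_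
    · intro i hi
      simp only [Finset.mem_filter, Finset.mem_univ, true_and] at hi ⊢
      exact ⟨fun a b hab => Fin.castSucc_le_castSucc_iff.2 (hi hab), Fin.castSucc_ne_last _⟩
    · intro i _ j _ h
      funext a
      exact Fin.castSucc_injective _ (congrFun h a)
    · intro i hi
      simp only [Finset.mem_filter, Finset.mem_univ, true_and] at hi
      have hne : ∀ j, i j ≠ Fin.last m := fun j hj =>
        hi.2 (Fin.last_le_iff.1 (hj ▸ hi.1 (Fin.le_last j)))
      refine ⟨fun j => (i j).castPred (hne j), ?_, ?_⟩
      · simp only [Finset.mem_filter, Finset.mem_univ, true_and]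
        exact fun a b hab => Fin.castPred_le_castPred_iff.2 (hi.1 hab)
      · funext j
        simp
    · intro i _
      rfl
  rw [← hrest, ← hlast]
  refine Eq.trans ?_ (add_comm _ _)
  rw [hComplete, ← Finset.filter_filter, ← Finset.filter_filter,
    Finset.sum_filter_add_sum_filter_not]

theorem commute_hComplete [Semiring A] {n : ℕ} {x : Fin n → A} {y : A} (h : ∀ i, Commute y (x i))
    (k : ℕ) : Commute y (hComplete k x) := by
  classical
  refine Commute.sum_right _ _ _ fun i _ => Commute.list_prod_right _ _ fun z hz => ?_
  obtain ⟨j, rfl⟩ := (List.mem_ofFn' _ _).1 hz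
  exact h _

/-- The elementary symmetric polynomial `e_k(x₀, …, x_{m-1})` in the first `m` terms of a
sequence of pairwise commuting elements, defined by its recursion in `m`. -/
def elemSymm [Semiring A] (x : ℕ → A) : ℕ → ℕ → A
  | _, 0 => 1
  | 0, _ + 1 => 0
  | m + 1, k + 1 => elemSymm x m (k + 1) + x m * elemSymm x m k

theorem elemSymm_zero [Semiring A] (x : ℕ → A) (m : ℕ) : elemSymm x m 0 = 1 := by
  cases m <;> rfl

theorem commute_elemSymm [Semiring A] {x : ℕ → A} {y : A} (h : ∀ i, Commute y (x i)) (m k : ℕ) :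
    Commute y (elemSymm x m k) := by
  induction m generalizing k with
  | zero => cases k <;> simp [elemSymm]
  | succ m ih =>
    cases k with
    | zero => simp [elemSymm]
    | succ k => exact (ih _).add_right ((h m).mul_right (ih k))

/-- `h_k(x₀, …, x_{m-1})` as a function of the number `m` of variables. -/
noncomputable def completeSymm [Semiring A] (x : ℕ → A) (m k : ℕ) : A :=
  hComplete k fun i : Fin m => x i

theorem completeSymm_zero [Semiring A] (x : ℕ → A) (m : ℕ) : completeSymm x m 0 = 1 :=
  hComplete_zero _

theorem completeSymm_zero_succ [Semiring A] (x : ℕ → A) (k : ℕ) :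
    completeSymm x 0 (k + 1) = 0 :=
  hComplete_succ_of_isEmpty _ _

theorem completeSymm_succ_succ [Semiring A] {x : ℕ → A} (hx : ∀ i j, Commute (x i) (x j))
    (m k : ℕ) :
    completeSymm x (m + 1) (k + 1) =
      completeSymm x m (k + 1) + x m * completeSymm x (m + 1) k := by
  have h : Commute (x m) (completeSymm x (m + 1) k) := commute_hComplete (fun i => hx m i) k
  rw [h.eq]
  exact hComplete_succ_succ k _

/-- The identity `E(-z) H(z) = 1` between the generating series of the elementary and the complete
symmetric polynomials. -/
theorem elemSymm_mul_completeSymm [Ring A] {x : ℕ → A} (hx : ∀ i j, Commute (x i) (x j)) (m : ℕ) :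
    (PowerSeries.mk fun k => (-1) ^ k * elemSymm x m k) * PowerSeries.mk (completeSymm x m) =
      1 := by
  induction m with
  | zero =>
    have h1 : (PowerSeries.mk fun k => (-1) ^ k * elemSymm x 0 k) = 1 := by
      ext k
      cases k <;> simp [elemSymm, PowerSeries.coeff_one]
    have h2 : PowerSeries.mk (completeSymm x 0) = 1 := by
      ext k
      cases k <;> simp [completeSymm_zero, completeSymm_zero_succ, PowerSeries.coeff_one]
    rw [h1, h2, one_mul]
  | succ m ih =>
    have h1 : (PowerSeries.mk fun k => (-1) ^ k * elemSymm x (m + 1) k) =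
        (PowerSeries.mk fun k => (-1) ^ k * elemSymm x m k) *
          (1 - PowerSeries.X * PowerSeries.C (x m)) := by
      ext k
      rw [mul_sub, mul_one, ← mul_assoc]
      cases k with
      | zero => simp [elemSymm_zero]
      | succ k =>
        rw [map_sub, PowerSeries.coeff_mul_C, PowerSeries.coeff_succ_mul_X]
        simp only [PowerSeries.coeff_mk, elemSymm]
        rw [mul_assoc, ← (commute_elemSymm (hx m) m k).eq, pow_succ]
        noncomm_ring
    have h2 : (1 - PowerSeries.X * PowerSeries.C (x m)) * PowerSeries.mk (completeSymm x (m + 1)) =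
        PowerSeries.mk (completeSymm x m) := by
      ext k
      rw [sub_mul, one_mul, mul_assoc]
      cases k with
      | zero => simp [completeSymm_zero]
      | succ k =>
        rw [map_sub, PowerSeries.coeff_succ_X_mul, PowerSeries.coeff_C_mul]
        simp [completeSymm_succ_succ hx]
    rw [h1, mul_assoc, h2, ih]

/-- Since `h_k` is a polynomial in the `e_i` without constant term for `k > 0`, a submodule that
is stable under the `e_i` is stable under the `h_k`. -/
theorem completeSymm_mul_mem [Ring A] {R : Type*} [Ring R] [Module R A] {x : ℕ → A}
    (hx : ∀ i j, Commute (x i) (x j)) (m : ℕ) (I : Submodule R A) {v : A} (hv : v ∈ I)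
    (hI : ∀ i, ∀ y ∈ I, elemSymm x m i * y ∈ I) (k : ℕ) : completeSymm x m k * v ∈ I := by
  induction k using Nat.strong_induction_on with
  | _ k ih =>
    cases k with
    | zero => simpa [completeSymm_zero] using hv
    | succ k =>
      have h := congrArg (PowerSeries.coeff (k + 1)) (elemSymm_mul_completeSymm hx m)
      rw [PowerSeries.coeff_mul, Finset.Nat.antidiagonal_succ, Finset.sum_cons] at h
      simp only [PowerSeries.coeff_mk, elemSymm_zero, pow_zero, one_mul, Finset.sum_map,
        PowerSeries.coeff_one, Nat.add_one_ne_zero, if_false] at h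
      rw [eq_neg_of_add_eq_zero_left h, neg_mul, Finset.sum_mul]
      refine I.neg_mem (I.sum_mem fun p hp => ?_)
      have hle : p.2 < k + 1 := by
        have := Finset.HasAntidiagonal.mem_antidiagonal.1 hp
        omega
      have hmem := hI (p.1 + 1) _ (ih p.2 hle)
      rcases neg_one_pow_eq_or A (p.1 + 1) with hs | hs
      · simpa [hs, mul_assoc] using hmem
      · simpa [hs, mul_assoc] using hmem

end SymmetricPolynomials

/-! ### Coefficients in the group algebra -/

section Coefficients

variable {N : ℕ}

theorem coeff_single_mul_perm (g σ : Perm (Fin N)) (x : SymGroupAlg N) :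
    (MonoidAlgebra.single g 1 * x).coeff σ = x.coeff (g⁻¹ * σ) := by
  rw [MonoidAlgebra.coeff_single_mul_eq_mul_coeff (m₂ := g⁻¹ * σ), one_mul]
  intro τ _
  rw [eq_inv_mul_iff_mul_eq]

theorem coeff_mul_single_perm (g σ : Perm (Fin N)) (x : SymGroupAlg N) :
    (x * MonoidAlgebra.single g 1).coeff σ = x.coeff (σ * g⁻¹) := by
  rw [MonoidAlgebra.coeff_mul_single_eq_coeff_mul (m₂ := σ * g⁻¹), mul_one]
  intro τ _
  rw [eq_mul_inv_iff_mul_eq]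

theorem coeff_jucysMurphy_mul (b : Fin N) (x : SymGroupAlg N) (σ : Perm (Fin N)) :
    (jucysMurphy b * x).coeff σ = ∑ a with a < b, x.coeff (swap a b * σ) := by
  rw [jucysMurphy, Finset.sum_mul, MonoidAlgebra.coeff_sum, Finsupp.finsetSum_apply]
  exact Finset.sum_congr rfl fun a _ => by rw [coeff_single_mul_perm, swap_inv]

theorem coeff_permSum (S : Finset (Perm (Fin N))) (σ : Perm (Fin N)) :
    (permSum S).coeff σ = if σ ∈ S then 1 else 0 := by
  classical
  rw [permSum, MonoidAlgebra.coeff_sum, Finsupp.finsetSum_apply]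
  simp [MonoidAlgebra.coeff_single, Finsupp.single_apply]

theorem symGroupAlg_ext {x y : SymGroupAlg N} (h : ∀ σ, x.coeff σ = y.coeff σ) : x = y :=
  MonoidAlgebra.ext (Finsupp.ext h)

end Coefficients

/-! ### Counting products of Jucys–Murphy elements -/

/-- The common setting of the two expansions. Left multiplication by the Jucys–Murphy elements at
the letters `b₀ < b₁ < ⋯` moves a permutation `σ`, by transpositions `(a bᵢ)` with `a < bᵢ`, away
from a base set. The permutation `assoc σ` attached to `σ` decides whether such a move cuts a cycle
(when `a` and `bᵢ` lie in one cycle of `assoc σ`), and `type σ` is the multiset of the reduced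
cycle lengths. In one case `assoc σ = σ` and the base set is `{1}`; in the other `assoc σ` is the
product of two fixed point free involutions and the base set is the hyperoctahedral group. -/
structure JucysMurphyModel (N n : ℕ) where
  /-- The letters `b₀ < b₁ < ⋯`. -/
  letter : Fin n → Fin N
  /-- The permutations of rank `0`. -/
  base : Finset (Perm (Fin N))
  /-- The permutation whose cycles are cut and joined. -/
  assoc : Perm (Fin N) → Perm (Fin N)
  /-- The reduced type of a permutation; the sum of its parts is the rank. -/
  type : Perm (Fin N) → Multiset ℕ
  letter_strictMono : StrictMono letter
  assoc_swap_mul_apply : ∀ (σ : Perm (Fin N)) (i j : Fin n) (a : Fin N), i ≤ j → a < letter i →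
    assoc (swap a (letter i) * σ) (letter j) = swap a (letter i) (assoc σ (letter j))
  le_of_sameCycle : ∀ (σ : Perm (Fin N)) (i : Fin n) (a : Fin N),
    (∀ j, i < j → assoc σ (letter j) = letter j) → SameCycle (assoc σ) (letter i) a → a ≤ letter i
  rank_of_sameCycle : ∀ (σ : Perm (Fin N)) (i : Fin n) (a : Fin N), a ≠ letter i →
    SameCycle (assoc σ) (letter i) a →
      (type (swap a (letter i) * σ)).sum + 1 = (type σ).sum
  rank_of_not_sameCycle : ∀ (σ : Perm (Fin N)) (i : Fin n) (a : Fin N),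
    ¬ SameCycle (assoc σ) (letter i) a → (type σ).sum ≤ (type (swap a (letter i) * σ)).sum
  weight_eq : ∀ (σ : Perm (Fin N)) (i : Fin n), assoc σ (letter i) ≠ letter i →
    catalanWeight (type σ) = ∑ a with a ≠ letter i ∧ SameCycle (assoc σ) (letter i) a,
      catalanWeight (type (swap a (letter i) * σ))
  mem_base_iff : ∀ σ, σ ∈ base ↔ ∀ j, assoc σ (letter j) = letter j
  type_of_mem_base : ∀ σ ∈ base, type σ = 0

namespace JucysMurphyModel

variable {N n : ℕ} (M : JucysMurphyModel N n)

/-- The Jucys–Murphy elements at the letters of the model, continued by `0` beyond them. -/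
noncomputable def element (i : ℕ) : SymGroupAlg N :=
  if h : i < n then jucysMurphy (M.letter ⟨i, h⟩) else 0

theorem element_commute (i j : ℕ) : Commute (M.element i) (M.element j) := by
  unfold element
  split_ifs
  · exact jucysMurphy_commute _ _
  all_goals simp

theorem completeSymm_element (k : ℕ) :
    completeSymm M.element n k = hComplete k fun i : Fin n => jucysMurphy (M.letter i) := by
  simp [completeSymm, element]

/-- The permutations whose associated permutation fixes the letters `b_m, b_{m+1}, …`: those which
can be reached with the first `m` Jucys–Murphy elements. -/
def Level (m : ℕ) (σ : Perm (Fin N)) : Prop :=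
  ∀ j : Fin n, m ≤ j → M.assoc σ (M.letter j) = M.letter j

variable {M}

theorem level_of_mem_base {σ : Perm (Fin N)} (h : σ ∈ M.base) (m : ℕ) : M.Level m σ :=
  fun j _ => (M.mem_base_iff σ).1 h j

theorem mem_base_of_level_zero {σ : Perm (Fin N)} (h : M.Level 0 σ) : σ ∈ M.base :=
  (M.mem_base_iff σ).2 fun j => h j (Nat.zero_le _)

theorem Level.succ {m : ℕ} {σ : Perm (Fin N)} (h : M.Level m σ) : M.Level (m + 1) σ :=
  fun j hj => h j (by omega)

theorem level_top (σ : Perm (Fin N)) : M.Level n σ := fun j hj => absurd j.2 (by omega)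

theorem level_iff_of_level_succ {i : Fin n} {σ : Perm (Fin N)} (h : M.Level (i + 1) σ) :
    M.Level i σ ↔ M.assoc σ (M.letter i) = M.letter i := by
  refine ⟨fun h' => h' i le_rfl, fun h' j hj => ?_⟩
  rcases eq_or_lt_of_le hj with hj | hj
  · rw [← Fin.ext hj]; exact h'
  · exact h j hj

theorem Level.swap_mul {i : Fin n} {σ : Perm (Fin N)} (h : M.Level (i + 1) σ) {a : Fin N}
    (ha : a < M.letter i) : M.Level (i + 1) (swap a (M.letter i) * σ) := by
  intro j hj
  have hij : i < j := hj
  have hlt := M.letter_strictMono hij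
  rw [M.assoc_swap_mul_apply σ i j a hij.le ha, h j hj,
    swap_apply_of_ne_of_ne (ha.trans hlt).ne' hlt.ne']

theorem level_succ_swap_mul_iff {i : Fin n} {σ : Perm (Fin N)} {a : Fin N}
    (ha : a < M.letter i) : M.Level (i + 1) (swap a (M.letter i) * σ) ↔ M.Level (i + 1) σ := by
  refine ⟨fun h => ?_, fun h => h.swap_mul ha⟩
  simpa using h.swap_mul ha

/-- The move by `(a bᵢ)` fixes the letter `bᵢ` exactly if `a` is its image. -/
theorem level_swap_mul_iff {i : Fin n} {σ : Perm (Fin N)} {a : Fin N} (ha : a < M.letter i) :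
    M.Level i (swap a (M.letter i) * σ) ↔
      M.Level (i + 1) σ ∧ M.assoc σ (M.letter i) = a := by
  have key : M.assoc (swap a (M.letter i) * σ) (M.letter i) = M.letter i ↔
      M.assoc σ (M.letter i) = a := by
    rw [M.assoc_swap_mul_apply σ i i a le_rfl ha, Equiv.swap_apply_eq_iff, swap_apply_right]
  constructor
  · intro h
    exact ⟨(level_succ_swap_mul_iff ha).1 h.succ, key.1 (h i le_rfl)⟩
  · rintro ⟨h1, h2⟩
    exact (level_iff_of_level_succ (h1.swap_mul ha)).2 (key.2 h2)

theorem apply_letter_lt {i : Fin n} {σ : Perm (Fin N)} (h : M.Level (i + 1) σ)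
    (h' : ¬ M.Level i σ) : M.assoc σ (M.letter i) < M.letter i := by
  rw [level_iff_of_level_succ h] at h'
  exact lt_of_le_of_ne (M.le_of_sameCycle σ i _ (fun j hj => h j hj)
    (sameCycle_apply_right.2 (SameCycle.refl _ _))) h'

theorem rank_apply_letter {i : Fin n} {σ : Perm (Fin N)} (h : M.Level (i + 1) σ)
    (h' : ¬ M.Level i σ) :
    (M.type (swap (M.assoc σ (M.letter i)) (M.letter i) * σ)).sum + 1 = (M.type σ).sum :=
  M.rank_of_sameCycle σ i _ (apply_letter_lt h h').ne
    (sameCycle_apply_right.2 (SameCycle.refl _ _))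

theorem rank_le_of_level {i : Fin n} {σ : Perm (Fin N)} (h : M.Level i σ) {a : Fin N}
    (ha : a < M.letter i) : (M.type σ).sum ≤ (M.type (swap a (M.letter i) * σ)).sum :=
  M.rank_of_not_sameCycle σ i a fun hs => ha.ne' (hs.eq_of_left (h i le_rfl))

theorem rank_le_add_one (i : Fin n) (σ : Perm (Fin N)) (a : Fin N) (ha : a < M.letter i) :
    (M.type σ).sum ≤ (M.type (swap a (M.letter i) * σ)).sum + 1 := by
  by_cases hs : SameCycle (M.assoc σ) (M.letter i) a
  · exact (M.rank_of_sameCycle σ i a ha.ne hs).ge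
  · exact (M.rank_of_not_sameCycle σ i a hs).trans (Nat.le_succ _)

theorem mem_base_of_rank_eq_zero {m : ℕ} (hm : m ≤ n) {σ : Perm (Fin N)} (h : M.Level m σ)
    (h0 : (M.type σ).sum = 0) : σ ∈ M.base := by
  induction m with
  | zero => exact mem_base_of_level_zero h
  | succ m ih =>
    refine ih (by omega) (by_contra fun h' => ?_)
    have := rank_apply_letter (i := ⟨m, hm⟩) h h'
    omega

theorem level_and_rank_eq_zero_iff {m : ℕ} (hm : m ≤ n) {σ : Perm (Fin N)} :
    M.Level m σ ∧ (M.type σ).sum = 0 ↔ σ ∈ M.base :=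
  ⟨fun h => mem_base_of_rank_eq_zero hm h.1 h.2,
    fun h => ⟨level_of_mem_base h _, by simp [M.type_of_mem_base σ h]⟩⟩

variable (M)

/-- The elementary symmetric polynomials in the first `m` Jucys–Murphy elements sum up the
permutations of given rank, each of which is reached in exactly one way. -/
theorem coeff_elemSymm_mul {m : ℕ} (hm : m ≤ n) (k : ℕ) (σ : Perm (Fin N))
    [Decidable (M.Level m σ ∧ (M.type σ).sum = k)] :
    (elemSymm M.element m k * permSum M.base).coeff σ =
      if M.Level m σ ∧ (M.type σ).sum = k then 1 else 0 := by
  classical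
  induction m generalizing k σ with
  | zero =>
    cases k with
    | zero =>
      rw [elemSymm_zero, one_mul, coeff_permSum]
      exact if_congr (level_and_rank_eq_zero_iff hm).symm rfl rfl
    | succ k =>
      rw [elemSymm, zero_mul, if_neg]
      · rfl
      rintro ⟨h, h'⟩
      rw [M.type_of_mem_base σ (mem_base_of_level_zero h)] at h'
      simp at h'
  | succ m ih =>
    cases k with
    | zero =>
      rw [elemSymm_zero, one_mul, coeff_permSum]
      exact if_congr (level_and_rank_eq_zero_iff hm).symm rfl rfl
    | succ k =>
      have hx : M.element m = jucysMurphy (M.letter ⟨m, hm⟩) := dif_pos hm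
      have hsum : ∀ a ∈ Finset.univ.filter fun a => a < M.letter ⟨m, hm⟩,
          (elemSymm M.element m k * permSum M.base).coeff (swap a (M.letter ⟨m, hm⟩) * σ) =
            if a = M.assoc σ (M.letter ⟨m, hm⟩) then
              if M.Level (m + 1) σ ∧ (M.type (swap a (M.letter ⟨m, hm⟩) * σ)).sum = k
                then 1 else 0 else 0 := by
        intro a ha
        have ha' := (Finset.mem_filter.1 ha).2
        have hl := level_swap_mul_iff (M := M) (σ := σ) ha'
        rw [ih (by omega), ← ite_and]
        refine if_congr ?_ rfl rfl
        constructor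
        · rintro ⟨h1, h2⟩
          exact ⟨(hl.1 h1).2.symm, (hl.1 h1).1, h2⟩
        · rintro ⟨h1, h2, h3⟩
          exact ⟨hl.2 ⟨h2, h1.symm⟩, h3⟩
      rw [elemSymm, add_mul, MonoidAlgebra.coeff_add, Finsupp.add_apply, ih (by omega), hx,
        mul_assoc, coeff_jucysMurphy_mul, Finset.sum_congr rfl hsum, Finset.sum_ite_eq']
      by_cases h1 : M.Level (m + 1) σ
      · by_cases h2 : M.Level m σ
        · have : M.assoc σ (M.letter ⟨m, hm⟩) = M.letter ⟨m, hm⟩ := h2 ⟨m, hm⟩ le_rfl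
          simp [h1, h2, this]
        · have h3 := apply_letter_lt (i := ⟨m, hm⟩) h1 h2
          have h4 := rank_apply_letter (i := ⟨m, hm⟩) h1 h2
          simp [h1, h2, h3, ← h4]
      · have h2 : ¬ M.Level m σ := fun h => h1 h.succ
        simp [h1, h2]

/-- The top coefficients of the complete symmetric polynomials in the first `m` Jucys–Murphy
elements: a permutation of rank `> k` does not occur in degree `k`, and one of rank `k` occurs
as often as its Catalan weight says. -/
theorem coeff_completeSymm_mul {m : ℕ} (hm : m ≤ n) (k : ℕ) (σ : Perm (Fin N)) :
    ((¬ M.Level m σ ∨ k < (M.type σ).sum) →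
      (completeSymm M.element m k * permSum M.base).coeff σ = 0) ∧
    (M.Level m σ → (M.type σ).sum = k →
      (completeSymm M.element m k * permSum M.base).coeff σ = catalanWeight (M.type σ)) := by
  classical
  induction k generalizing m σ with
  | zero =>
    rw [completeSymm_zero, one_mul, coeff_permSum]
    constructor
    · rintro h
      rw [if_neg fun h' => ?_]
      have := (level_and_rank_eq_zero_iff hm).2 h'
      rcases h with h | h
      · exact h this.1
      · omega
    · intro h h0
      have hb := (level_and_rank_eq_zero_iff hm).1 ⟨h, h0⟩
      simp [hb, M.type_of_mem_base σ hb, catalanWeight]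
  | succ k ihk =>
    induction m generalizing σ with
    | zero =>
      rw [completeSymm_zero_succ, zero_mul]
      refine ⟨fun _ => rfl, fun h h' => ?_⟩
      rw [M.type_of_mem_base σ (mem_base_of_level_zero h)] at h'
      simp at h'
    | succ m ihm =>
      have hx : M.element m = jucysMurphy (M.letter ⟨m, hm⟩) := dif_pos hm
      have ihm := ihm (by omega) σ
      have ihk := fun σ => ihk hm σ
      rw [completeSymm_succ_succ M.element_commute, add_mul, MonoidAlgebra.coeff_add,
        Finsupp.add_apply, hx, mul_assoc, coeff_jucysMurphy_mul]
      constructor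
      · intro h
        have h' : ¬ M.Level m σ ∨ k + 1 < (M.type σ).sum :=
          h.imp_left fun h1 h2 => h1 h2.succ
        rw [ihm.1 h', zero_add]
        refine Finset.sum_eq_zero fun a ha => (ihk _).1 ?_
        have ha' := (Finset.mem_filter.1 ha).2
        rcases h with h | h
        · exact Or.inl fun h1 => h ((level_succ_swap_mul_iff (i := ⟨m, hm⟩) ha').1 h1)
        · have := rank_le_add_one ⟨m, hm⟩ σ a ha'
          exact Or.inr (by omega)
      · intro h1 hr
        by_cases h2 : M.Level m σ
        · rw [ihm.2 h2 hr, Finset.sum_eq_zero, add_zero]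
          intro a ha
          have := rank_le_of_level (i := ⟨m, hm⟩) h2 (Finset.mem_filter.1 ha).2
          exact (ihk _).1 (Or.inr (by omega))
        · have hne : M.assoc σ (M.letter ⟨m, hm⟩) ≠ M.letter ⟨m, hm⟩ := fun h =>
            h2 ((level_iff_of_level_succ (i := ⟨m, hm⟩) h1).2 h)
          rw [ihm.1 (Or.inl h2), zero_add, M.weight_eq σ ⟨m, hm⟩ hne, Nat.cast_sum]
          symm
          -- Only the moves that cut the cycle through `b_m` lower the rank.
          refine Finset.sum_subset_zero_on_sdiff ?_ ?_ ?_
          · intro a ha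
            obtain ⟨hab, hs⟩ := (Finset.mem_filter.1 ha).2
            exact Finset.mem_filter.2 ⟨Finset.mem_univ _, lt_of_le_of_ne
              (M.le_of_sameCycle σ ⟨m, hm⟩ a (fun j hj => h1 j hj) hs) hab⟩
          · intro a ha
            obtain ⟨ha1, ha2⟩ := Finset.mem_sdiff.1 ha
            have ha' := (Finset.mem_filter.1 ha1).2
            have hs : ¬ SameCycle (M.assoc σ) (M.letter ⟨m, hm⟩) a := fun hs =>
              ha2 (Finset.mem_filter.2 ⟨Finset.mem_univ _, ha'.ne, hs⟩)
            have := M.rank_of_not_sameCycle σ ⟨m, hm⟩ a hs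
            exact (ihk _).1 (Or.inr (by omega))
          · intro a ha
            obtain ⟨hab, hs⟩ := (Finset.mem_filter.1 ha).2
            have hlt := lt_of_le_of_ne
              (M.le_of_sameCycle σ ⟨m, hm⟩ a (fun j hj => h1 j hj) hs) hab
            have := M.rank_of_sameCycle σ ⟨m, hm⟩ a hab hs
            exact ((ihk _).2 (Level.swap_mul (i := ⟨m, hm⟩) h1 hlt) (by omega)).symm

end JucysMurphyModel

/-! ### Pairs of fixed point free involutions -/

/-- A fixed point free involution, i.e. a perfect matching of the letters. -/
structure IsPairing {α : Type*} (t : Perm α) : Prop where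
  apply_apply : ∀ x, t (t x) = x
  apply_ne : ∀ x, t x ≠ x

/-- A set `A` which is stable under `f` and contains exactly one letter of each pair of `t`.
For `f = s * t` with a further pairing `s`, the cycles of `f` come in pairs that are interchanged
by `t`, and `A` is the union of one cycle from each pair. -/
structure IsHalf {α : Type*} (t f : Perm α) (A : Finset α) : Prop where
  apply_mem : ∀ x, f x ∈ A ↔ x ∈ A
  flip_mem : ∀ x, t x ∈ A ↔ x ∉ A

section Pairings

variable {α : Type*}

theorem IsPairing.conj {t : Perm α} (h : IsPairing t) (σ : Perm α) : IsPairing (σ * t * σ⁻¹) where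
  apply_apply x := by simp [Perm.mul_apply, h.apply_apply]
  apply_ne x hx := h.apply_ne (σ⁻¹ x) (by
    rw [Perm.eq_inv_iff_eq]
    exact hx)

variable {s t : Perm α}

theorem IsPairing.mul_self (h : IsPairing t) : t * t = 1 := Perm.ext fun x => h.apply_apply x

theorem IsPairing.inv_eq (h : IsPairing t) : t⁻¹ = t := inv_eq_of_mul_eq_one_left h.mul_self

theorem IsPairing.apply_eq_iff (h : IsPairing t) {x y : α} : t x = y ↔ x = t y :=
  ⟨fun e => by rw [← e, h.apply_apply], fun e => by rw [e, h.apply_apply]⟩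

theorem IsPairing.apply_zpow_mul (hs : IsPairing s) (ht : IsPairing t) (i : ℤ) (x : α) :
    t (((s * t) ^ i) x) = ((s * t) ^ (-i)) (t x) := by
  have h : t * (s * t) * t⁻¹ = (s * t)⁻¹ := by
    rw [mul_inv_rev, hs.inv_eq, ht.inv_eq, mul_assoc, mul_assoc, ht.mul_self, mul_one]
  have h2 : t * (s * t) ^ i * t⁻¹ = (s * t) ^ (-i) := by
    rw [← conj_zpow, h, inv_zpow, zpow_neg]
  rw [← h2]
  simp

/-- A letter and its partner are never on the same cycle of the product of two pairings: the
partner map would act on the cycle as a reflection, and either it or the other pairing would have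
a fixed point. -/
theorem IsPairing.not_sameCycle (hs : IsPairing s) (ht : IsPairing t) (x : α) :
    ¬ SameCycle (s * t) x (t x) := by
  rintro ⟨i, hi⟩
  rcases Int.even_or_odd' i with ⟨j, rfl | rfl⟩
  · apply ht.apply_ne (((s * t) ^ j) x)
    rw [hs.apply_zpow_mul ht, ← hi, ← Perm.mul_apply, ← zpow_add]
    congr 2
    ring
  · apply hs.apply_ne (((s * t) ^ (j + 1)) x)
    have h1 : t (((s * t) ^ (j + 1)) x) = ((s * t) ^ j) x := by
      rw [hs.apply_zpow_mul ht, ← hi, ← Perm.mul_apply, ← zpow_add]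
      congr 2
      ring
    have h2 : ((s * t) ^ (j + 1)) x = s (t (((s * t) ^ j) x)) := by
      rw [add_comm, zpow_add, zpow_one]; rfl
    have h3 : s (((s * t) ^ (j + 1)) x) = t (((s * t) ^ j) x) := by
      rw [h2, hs.apply_apply]
    rw [h3, ← h1, ht.apply_apply]

theorem IsPairing.sameCycle_flip (hs : IsPairing s) (ht : IsPairing t) {x y : α}
    (h : SameCycle (s * t) x y) : SameCycle (s * t) (t x) (t y) := by
  obtain ⟨i, rfl⟩ := h
  exact ⟨-i, (hs.apply_zpow_mul ht i x).symm⟩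

theorem IsHalf.compl [Fintype α] [DecidableEq α] {t f : Perm α} {A : Finset α}
    (h : IsHalf t f A) : IsHalf t f Aᶜ where
  apply_mem x := by simp [h.apply_mem]
  flip_mem x := by simp [h.flip_mem]

theorem exists_isHalf [Fintype α] [LinearOrder α] (hs : IsPairing s) (ht : IsPairing t) (b : α) :
    ∃ A, IsHalf t (s * t) A ∧ b ∈ A := by
  classical
  -- `r` chooses a representative of each cycle; of two partner cycles, the one with the smaller
  -- representative is taken.
  let r : α → α := fun x => (Quotient.mk (SameCycle.setoid (s * t)) x).out
  have hr : ∀ x y, SameCycle (s * t) x y → r x = r y := fun x y h =>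
    congrArg Quotient.out (Quotient.sound (s := SameCycle.setoid (s * t)) h)
  have hr' : ∀ x, SameCycle (s * t) (r x) x := fun x =>
    Quotient.mk_out (s := SameCycle.setoid (s * t)) x
  have hne : ∀ x, r x ≠ r (t x) := fun x h =>
    hs.not_sameCycle ht x ((hr' x).symm.trans (h ▸ hr' (t x)))
  have happ : ∀ x, SameCycle (s * t) ((s * t) x) x := fun x =>
    sameCycle_apply_left.2 (SameCycle.refl _ _)
  let A : Finset α := Finset.univ.filter fun x => r x < r (t x)
  have hA : IsHalf t (s * t) A := by
    constructor
    · intro x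
      simp only [A, Finset.mem_filter, Finset.mem_univ, true_and]
      rw [hr _ _ (happ x), hr _ _ (hs.sameCycle_flip ht (happ x))]
    · intro x
      simp only [A, Finset.mem_filter, Finset.mem_univ, true_and, ht.apply_apply]
      rw [not_lt]
      exact ⟨le_of_lt, fun h => lt_of_le_of_ne h (hne x).symm⟩
  by_cases hb : b ∈ A
  · exact ⟨A, hA, hb⟩
  · exact ⟨Aᶜ, hA.compl, by simpa using hb⟩

theorem swap_mem_iff [DecidableEq α] {A : Finset α} {a b : α} (ha : a ∈ A) (hb : b ∈ A) (x : α) :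
    swap a b x ∈ A ↔ x ∈ A := by
  rw [swap_apply_def]
  split_ifs with h1 h2
  · subst h1; simp [ha, hb]
  · subst h2; simp [ha, hb]
  · rfl

variable [DecidableEq α]

/-- The permutation that agrees with `f` on a set stable under `f` and is the identity off it. -/
def restrictPerm {f : Perm α} {A : Finset α} (h : ∀ x, f x ∈ A ↔ x ∈ A) : Perm α :=
  ofSubtype (f.subtypePerm (p := fun x => x ∈ A) h)

theorem restrictPerm_of_mem {f : Perm α} {A : Finset α} (h : ∀ x, f x ∈ A ↔ x ∈ A) {x : α}
    (hx : x ∈ A) : restrictPerm h x = f x :=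
  ofSubtype_subtypePerm_of_mem (p := fun x => x ∈ A) h hx

theorem restrictPerm_of_notMem {f : Perm α} {A : Finset α} (h : ∀ x, f x ∈ A ↔ x ∈ A) {x : α}
    (hx : x ∉ A) : restrictPerm h x = x :=
  ofSubtype_subtypePerm_of_not_mem (p := fun x => x ∈ A) h hx

theorem mem_of_restrictPerm_ne {f : Perm α} {A : Finset α} (h : ∀ x, f x ∈ A ↔ x ∈ A) {x : α}
    (hx : restrictPerm h x ≠ x) : x ∈ A :=
  by_contra fun h' => hx (restrictPerm_of_notMem h h')

theorem restrictPerm_pow {f : Perm α} {A : Finset α} (h : ∀ x, f x ∈ A ↔ x ∈ A) {x : α}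
    (hx : x ∈ A) (k : ℕ) : (restrictPerm h ^ k) x = (f ^ k) x ∧ (f ^ k) x ∈ A := by
  induction k with
  | zero => simpa using hx
  | succ k ih =>
    rw [pow_succ', pow_succ', Perm.mul_apply, Perm.mul_apply, ih.1,
      restrictPerm_of_mem h ih.2]
    exact ⟨rfl, (h _).2 ih.2⟩

theorem sameCycle_restrictPerm [Finite α] {f : Perm α} {A : Finset α}
    (h : ∀ x, f x ∈ A ↔ x ∈ A) {x y : α} (hx : x ∈ A) :
    SameCycle (restrictPerm h) x y ↔ SameCycle f x y := by
  constructor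
  · intro hs
    obtain ⟨k, rfl⟩ := hs.exists_nat_pow_eq
    rw [(restrictPerm_pow h hx k).1]
    exact ⟨k, by simp⟩
  · intro hs
    obtain ⟨k, rfl⟩ := hs.exists_nat_pow_eq
    rw [← (restrictPerm_pow h hx k).1]
    exact ⟨k, by simp⟩

theorem IsHalf.mem_of_sameCycle [Finite α] {t f : Perm α} {A : Finset α} (h : IsHalf t f A)
    {x y : α} (hx : x ∈ A) (hs : SameCycle f x y) : y ∈ A := by
  obtain ⟨k, rfl⟩ := hs.exists_nat_pow_eq
  exact (restrictPerm_pow h.apply_mem hx k).2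

variable [Fintype α]

theorem IsHalf.two_mul_card (ht : IsPairing t) {f : Perm α} {A : Finset α} (h : IsHalf t f A) :
    2 * A.card = Fintype.card α := by
  have himg : A.map t.toEmbedding = Aᶜ := by
    ext x
    simp only [Finset.mem_map_equiv, Finset.mem_compl]
    rw [show t.symm = t from ht.inv_eq, h.flip_mem]
  have h1 := Finset.card_map t.toEmbedding (s := A)
  rw [himg] at h1
  have h2 := Finset.card_add_card_compl A
  omega

/-- The two halves carry inverse copies of the same permutation. -/
theorem IsHalf.rank_eq (hs : IsPairing s) (ht : IsPairing t) {A : Finset α}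
    (h : IsHalf t (s * t) A) :
    (reducedCycleType (s * t)).sum = 2 * (reducedCycleType (restrictPerm h.apply_mem)).sum := by
  have hprod : s * t = restrictPerm h.apply_mem * restrictPerm h.compl.apply_mem := by
    ext x
    rw [Perm.mul_apply (restrictPerm _)]
    by_cases hx : x ∈ A
    · rw [restrictPerm_of_notMem h.compl.apply_mem (by simpa using hx),
        restrictPerm_of_mem _ hx]
    · have hx' : x ∈ Aᶜ := by simpa using hx
      rw [restrictPerm_of_mem h.compl.apply_mem hx', restrictPerm_of_notMem]
      rwa [h.apply_mem]
  have hdis : Disjoint (restrictPerm h.apply_mem) (restrictPerm h.compl.apply_mem) := by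
    intro x
    by_cases hx : x ∈ A
    · exact Or.inr (restrictPerm_of_notMem _ (by simpa using hx))
    · exact Or.inl (restrictPerm_of_notMem _ hx)
  have hconj : restrictPerm h.compl.apply_mem =
      t * (restrictPerm h.apply_mem)⁻¹ * t⁻¹ := by
    rw [← inv_inj, mul_inv_rev, mul_inv_rev, inv_inv, inv_inv, inv_eq_iff_mul_eq_one]
    ext x
    rw [ht.inv_eq]
    simp only [Perm.mul_apply, Perm.one_apply]
    by_cases hx : t x ∈ A
    · have h1 : t ((s * t) (t x)) ∉ A := by
        rw [h.flip_mem, not_not, h.apply_mem]; exact hx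
      rw [restrictPerm_of_mem h.apply_mem hx, restrictPerm_of_mem _ (by simpa using h1)]
      simp [ht.apply_apply, hs.apply_apply]
    · have h1 : x ∈ A := by rw [h.flip_mem, not_not] at hx; exact hx
      rw [restrictPerm_of_notMem h.apply_mem hx, ht.apply_apply,
        restrictPerm_of_notMem _ (by simpa using h1)]
  conv_lhs => rw [hprod]
  rw [reducedCycleType_mul_of_disjoint hdis, Multiset.sum_add, hconj]
  simp only [reducedCycleType, cycleType_conj, cycleType_inv]
  ring

theorem map_succ_reducedCycleType (f : Perm α) :
    (reducedCycleType f).map (fun m => m + 1) = f.cycleType := by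
  rw [reducedCycleType, Multiset.map_map]
  conv_rhs => rw [← Multiset.map_id f.cycleType]
  refine Multiset.map_congr rfl fun m hm => ?_
  have := two_le_of_mem_cycleType hm
  simp only [Function.comp_apply, id]
  omega

theorem cycleType_eq_of_reducedCycleType_eq {f g : Perm α}
    (h : reducedCycleType f = reducedCycleType g) : f.cycleType = g.cycleType := by
  rw [← map_succ_reducedCycleType, h, map_succ_reducedCycleType]

/-- Two permutations with the same cycle type, living on stable sets of the same size, are
conjugate by a bijection of these sets. -/
theorem exists_equiv_of_cycleType_restrictPerm_eq {f f' : Perm α} {A A' : Finset α}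
    (h : ∀ x, f x ∈ A ↔ x ∈ A) (h' : ∀ x, f' x ∈ A' ↔ x ∈ A') (hcard : A.card = A'.card)
    (ht : (restrictPerm h).cycleType = (restrictPerm h').cycleType) :
    ∃ e : A ≃ A', ∀ x : A, (e ⟨f x, (h x).2 x.2⟩ : α) = f' (e x) := by
  let e : A ≃ A' := Finset.equivOfCardEq hcard
  let g : Perm A := f.subtypePerm h
  let g' : Perm A' := f'.subtypePerm h'
  have hG : ∀ x, (g.extendDomain (p := fun x => x ∈ A') e) x ∈ A' ↔ x ∈ A' := by
    intro x
    by_cases hx : x ∈ A'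
    · rw [g.extendDomain_apply_subtype (p := fun x => x ∈ A') e hx]
      exact iff_of_true (e _).2 hx
    · rw [g.extendDomain_apply_not_subtype (p := fun x => x ∈ A') e hx]
  let g'' : Perm A' := (g.extendDomain (p := fun x => x ∈ A') e).subtypePerm hG
  have hct : g''.cycleType = g'.cycleType := by
    have h1 : ofSubtype g'' = g.extendDomain (p := fun x => x ∈ A') e :=
      ofSubtype_subtypePerm _ fun x hx => by_contra fun hx' =>
        hx (g.extendDomain_apply_not_subtype (p := fun x => x ∈ A') e hx')
    have h2 : g''.cycleType = g.cycleType := by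
      rw [← cycleType_ofSubtype, h1]
      exact cycleType_extendDomain _
    have h3 : (restrictPerm h).cycleType = g.cycleType := cycleType_ofSubtype
    have h4 : (restrictPerm h').cycleType = g'.cycleType := cycleType_ofSubtype
    rw [h2, ← h3, ht, h4]
  obtain ⟨c, hc⟩ := isConj_iff.1 (isConj_of_cycleType_eq hct)
  refine ⟨e.trans c, fun x => ?_⟩
  have h5 : g'' (e x) = e (g x) := by
    apply Subtype.ext
    exact (g.extendDomain_apply_image (p := fun x => x ∈ A') e x)
  have h6 : c (g'' (e x)) = g' (c (e x)) := by
    rw [← hc]; simp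
  rw [h5] at h6
  exact congrArg Subtype.val h6

/-- A pair of pairings is determined up to simultaneous conjugation by the cycle type of the
product on a half. -/
theorem exists_commute_conj_eq {s' : Perm α} (hs : IsPairing s) (hs' : IsPairing s')
    (ht : IsPairing t) {A A' : Finset α} (h : IsHalf t (s * t) A) (h' : IsHalf t (s' * t) A')
    (hct : (restrictPerm h.apply_mem).cycleType = (restrictPerm h'.apply_mem).cycleType) :
    ∃ g : Perm α, g * t = t * g ∧ g * s = s' * g := by
  have hcard : A.card = A'.card := by
    have h1 := h.two_mul_card ht
    have h2 := h'.two_mul_card ht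
    omega
  obtain ⟨e, he⟩ := exists_equiv_of_cycleType_restrictPerm_eq h.apply_mem h'.apply_mem hcard hct
  have hfl : ∀ {x}, x ∉ A → t x ∈ A := fun hx => (h.flip_mem _).2 hx
  let g₀ : α → α := fun x => if hx : x ∈ A then e ⟨x, hx⟩ else t (e ⟨t x, hfl hx⟩)
  have hg₁ : ∀ x (hx : x ∈ A), g₀ x = e ⟨x, hx⟩ := fun x hx => dif_pos hx
  have hg₂ : ∀ x (hx : x ∉ A), g₀ x = t (e ⟨t x, hfl hx⟩) := fun x hx => dif_neg hx
  have hmem : ∀ x, g₀ x ∈ A' ↔ x ∈ A := by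
    intro x
    by_cases hx : x ∈ A
    · rw [hg₁ x hx]; exact iff_of_true (e _).2 hx
    · rw [hg₂ x hx, h'.flip_mem]; exact iff_of_false (not_not.2 (e _).2) hx
  have hinj : Function.Injective g₀ := by
    intro x y hxy
    have hiff : x ∈ A ↔ y ∈ A := by rw [← hmem x, ← hmem y, hxy]
    by_cases hx : x ∈ A
    · have hy := hiff.1 hx
      rw [hg₁ x hx, hg₁ y hy] at hxy
      exact congrArg Subtype.val (e.injective (Subtype.ext hxy))
    · have hy := fun h => hx (hiff.2 h)
      rw [hg₂ x hx, hg₂ y hy] at hxy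
      exact t.injective (congrArg Subtype.val (e.injective (Subtype.ext (t.injective hxy))))
  have hgt : ∀ x, g₀ (t x) = t (g₀ x) := by
    intro x
    by_cases hx : x ∈ A
    · have hx' : t x ∉ A := by rw [h.flip_mem]; exact not_not.2 hx
      rw [hg₁ x hx, hg₂ _ hx']
      simp only [ht.apply_apply]
    · rw [hg₂ x hx, hg₁ _ (hfl hx), ht.apply_apply]
  have hgf : ∀ x ∈ A, g₀ ((s * t) x) = (s' * t) (g₀ x) := by
    intro x hx
    rw [hg₁ x hx, hg₁ _ ((h.apply_mem x).2 hx)]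
    exact he ⟨x, hx⟩
  have hgs : ∀ x, g₀ (s x) = s' (g₀ x) := by
    intro x
    by_cases hx : x ∈ A
    · -- Here `s x` is the partner of the preimage of `x` under `s * t`.
      have hy : t (s x) ∈ A := by
        rw [← h.apply_mem]
        simpa [ht.apply_apply, hs.apply_apply] using hx
      have := hgf _ hy
      simp only [Perm.mul_apply, ht.apply_apply, hs.apply_apply, hgt] at this
      rw [this, hs'.apply_apply]
    · have := hgf _ (hfl hx)
      simpa [ht.apply_apply, hgt] using this
  refine ⟨Equiv.ofBijective g₀ (Finite.injective_iff_bijective.1 hinj), ?_, ?_⟩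
  · ext x; exact hgt x
  · ext x; exact hgs x

/-- The components of the graph whose edges are the pairs of two pairings correspond to the cycles
of the product of the pairings on a half, and have twice their size. -/
theorem reduction_ncard_components (hs : IsPairing s) (ht : IsPairing t) {A : Finset α}
    (h : IsHalf t (s * t) A) (G : SimpleGraph α)
    (hG : ∀ x y, G.Adj x y ↔ y = t x ∨ y = s x) [Fintype G.ConnectedComponent] :
    reduction ((Finset.univ : Finset G.ConnectedComponent).val.map fun c => c.supp.ncard / 2) =
      reducedCycleType (restrictPerm h.apply_mem) := by
  classical
  have hreach : ∀ x y, G.Reachable x y →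
      SameCycle (s * t) x y ∨ SameCycle (s * t) x (t y) := by
    rintro x y ⟨w⟩
    induction w using SimpleGraph.Walk.concatRec with
    | Hnil => exact Or.inl (SameCycle.refl _ _)
    | Hconcat w hadj ih =>
      rename_i u v z
      rcases (hG _ _).1 hadj with rfl | rfl
      · rw [ht.apply_apply]; exact ih.symm
      · rcases ih with ih | ih
        · right
          rw [← sameCycle_apply_right]
          simpa [ht.apply_apply, hs.apply_apply] using ih
        · left
          rw [← sameCycle_apply_right] at ih
          simpa [ht.apply_apply] using ih
  have hreachA : ∀ x ∈ A, ∀ y ∈ A, G.Reachable x y → SameCycle (s * t) x y := by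
    intro x hx y hy hr
    refine (hreach x y hr).resolve_right fun hc => ?_
    exact (h.flip_mem y).1 (h.mem_of_sameCycle hx hc) hy
  have hflip : ∀ x, G.Reachable x (t x) := fun x => ((hG _ _).2 (Or.inl rfl)).reachable
  have hstep : ∀ x, G.Reachable x ((s * t) x) := fun x =>
    (hflip x).trans ((hG _ _).2 (Or.inr rfl)).reachable
  have hcyc : ∀ x y, SameCycle (s * t) x y → G.Reachable x y := by
    intro x y hxy
    obtain ⟨k, rfl⟩ := hxy.exists_nat_pow_eq
    induction k with
    | zero => exact SimpleGraph.Reachable.refl _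
    | succ k ih =>
      rw [pow_succ', Perm.mul_apply]
      exact (ih ⟨k, by simp⟩).trans (hstep _)
  have hrep : ∀ c : G.ConnectedComponent, ∃ x ∈ A, G.connectedComponentMk x = c := by
    intro c
    induction c using SimpleGraph.ConnectedComponent.ind with
    | _ x =>
      by_cases hx : x ∈ A
      · exact ⟨x, hx, rfl⟩
      · exact ⟨t x, (h.flip_mem x).2 hx,
          SimpleGraph.ConnectedComponent.sound (hflip x).symm⟩
  choose rep hrepA hrepc using hrep
  have hsupp : ∀ c : G.ConnectedComponent,
      c.supp.ncard / 2 = (Finset.univ.filter fun y => SameCycle (s * t) (rep c) y).card := by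
    intro c
    set S := Finset.univ.filter fun y => SameCycle (s * t) (rep c) y with hS
    have hSA : S ⊆ A := fun y hy => h.mem_of_sameCycle (hrepA c) (Finset.mem_filter.1 hy).2
    have hsup : c.supp = ↑(S ∪ S.map t.toEmbedding) := by
      ext y
      rw [SimpleGraph.ConnectedComponent.mem_supp_iff, ← hrepc c,
        SimpleGraph.ConnectedComponent.eq]
      simp only [Finset.coe_union, Set.mem_union, Finset.mem_coe, hS, Finset.mem_filter,
        Finset.mem_univ, true_and, Finset.mem_map_equiv, ← Perm.inv_def, ht.inv_eq]
      constructor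
      · intro hr
        exact hreach _ _ hr.symm
      · rintro (hr | hr)
        · exact (hcyc _ _ hr).symm
        · exact (hflip y).trans (hcyc _ _ hr).symm
    have hdis : _root_.Disjoint S (S.map t.toEmbedding) := by
      rw [Finset.disjoint_left]
      intro y hy hy'
      rw [Finset.mem_map_equiv, ← Perm.inv_def, ht.inv_eq] at hy'
      exact (h.flip_mem y).1 (hSA hy') (hSA hy)
    rw [hsup, Set.ncard_coe_finset, Finset.card_union_of_disjoint hdis, Finset.card_map]
    omega
  set g := restrictPerm h.apply_mem with hg
  have hcard : ∀ c : G.ConnectedComponent, rep c ∈ g.support →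
      c.supp.ncard / 2 = (g.cycleOf (rep c)).support.card := by
    intro c hc
    rw [hsupp]
    congr 1
    ext y
    rw [mem_support_cycleOf_iff, sameCycle_restrictPerm _ (hrepA c)]
    simp [hc]
  have hnontriv : ∀ c : G.ConnectedComponent,
      c.supp.ncard / 2 - 1 ≠ 0 ↔ rep c ∈ g.support := by
    intro c
    constructor
    · intro hc
      by_contra hns
      have hfix : (s * t) (rep c) = rep c := by
        rw [← restrictPerm_of_mem h.apply_mem (hrepA c)]
        exact notMem_support.1 hns
      apply hc
      have : (Finset.univ.filter fun y => SameCycle (s * t) (rep c) y) = {rep c} := by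
        ext y
        simp only [Finset.mem_filter, Finset.mem_univ, true_and, Finset.mem_singleton]
        exact ⟨fun hy => (hy.eq_of_left hfix).symm, fun hy => hy ▸ SameCycle.refl _ _⟩
      rw [hsupp, this]
      simp
    · intro hc
      rw [hcard c hc]
      have := two_le_card_support_cycleOf_iff.2 (mem_support.1 hc)
      omega
  rw [reduction, Multiset.map_map, Multiset.filter_map, reducedCycleType, cycleType_def,
    Multiset.map_map]
  refine Multiset.map_eq_map_of_bij_of_nodup _ _ (Multiset.Nodup.filter _ Finset.univ.nodup)
    g.cycleFactorsFinset.nodup (fun c _ => g.cycleOf (rep c)) ?_ ?_ ?_ ?_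
  · intro c hc
    exact cycleOf_mem_cycleFactorsFinset_iff.2 ((hnontriv c).1 (Multiset.mem_filter.1 hc).2)
  · intro c hc c' hc' heq
    have h1 := (hnontriv c).1 (Multiset.mem_filter.1 hc).2
    have h2 := (hnontriv c').1 (Multiset.mem_filter.1 hc').2
    have h3 := (sameCycle_iff_cycleOf_eq_of_mem_support h1 h2).2 heq
    rw [sameCycle_restrictPerm _ (hrepA c)] at h3
    rw [← hrepc c, ← hrepc c']
    exact SimpleGraph.ConnectedComponent.sound (hcyc _ _ h3)
  · intro c hc
    obtain ⟨x, hx⟩ := (mem_cycleFactorsFinset_iff.1 hc).1.nonempty_support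
    have hcx := cycle_is_cycleOf hx hc
    have hxg : x ∈ g.support := mem_cycleFactorsFinset_support_le hc hx
    have hxA : x ∈ A := mem_of_restrictPerm_ne h.apply_mem (mem_support.1 hxg)
    have hs' : SameCycle g (rep (G.connectedComponentMk x)) x := by
      rw [sameCycle_restrictPerm _ (hrepA _)]
      exact hreachA _ (hrepA _) _ hxA (SimpleGraph.ConnectedComponent.exact (hrepc _))
    have hr : rep (G.connectedComponentMk x) ∈ g.support := hs'.mem_support_iff.2 hxg
    exact ⟨G.connectedComponentMk x,
      Multiset.mem_filter.2 ⟨Finset.mem_univ _, (hnontriv _).2 hr⟩, by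
        rw [hcx]; exact hs'.cycleOf_eq⟩
  · intro c hc
    have h1 := (hnontriv c).1 (Multiset.mem_filter.1 hc).2
    simp only [Function.comp_apply]
    rw [hcard c h1]

end Pairings

/-! ### The model of conjugacy classes -/

/-- The unitary case: the identity is moved by `J₁, …, J_n`, and the cycles of a permutation itself
are cut and joined. -/
def unitaryModel (n : ℕ) : JucysMurphyModel n n where
  letter := id
  base := {1}
  assoc := id
  type := reducedCycleType
  letter_strictMono := strictMono_id
  assoc_swap_mul_apply σ i j a _ _ := rfl
  le_of_sameCycle σ i a hfix hs := by
    by_contra h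
    exact h (hs.eq_of_right (hfix a (not_le.1 h))).ge
  rank_of_sameCycle σ i a hne hs := rank_swap_mul_of_sameCycle hne hs
  rank_of_not_sameCycle σ i a hs := by
    simp only [id] at hs ⊢
    rw [rank_swap_mul_of_not_sameCycle hs]
    exact Nat.le_succ _
  weight_eq σ i hne := catalanWeight_eq_sum_swap_mul hne
  mem_base_iff σ := by
    rw [Finset.mem_singleton]
    exact Perm.ext_iff
  type_of_mem_base σ h := by
    rw [Finset.mem_singleton.1 h]
    simp [reducedCycleType]

/-! ### The model of double cosets of the hyperoctahedral group -/

section Hyperoctahedral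

variable {n : ℕ}

theorem oddLetter_injective : Function.Injective (oddLetter : Fin n → Fin (2 * n)) := by
  intro i j h
  have := congrArg Fin.val h
  simp only [oddLetter] at this
  exact Fin.ext (by omega)

theorem oddLetter_ne_evenLetter (i j : Fin n) : oddLetter i ≠ evenLetter j := by
  intro h
  have := congrArg Fin.val h
  simp only [oddLetter, evenLetter] at this
  omega

theorem evenLetter_injective : Function.Injective (evenLetter : Fin n → Fin (2 * n)) := by
  intro i j h
  have := congrArg Fin.val h
  simp only [evenLetter] at this
  exact Fin.ext (by omega)

theorem exists_eq_letter (x : Fin (2 * n)) : ∃ i, x = oddLetter i ∨ x = evenLetter i := by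
  refine ⟨⟨x / 2, by omega⟩, ?_⟩
  rcases Nat.mod_two_eq_zero_or_one x with h | h
  · left; apply Fin.ext; simp only [oddLetter]; omega
  · right; apply Fin.ext; simp only [evenLetter]; omega

theorem prod_swap_letters_apply (l : List (Fin n)) (hl : l.Nodup) (i : Fin n) :
    (l.map fun i => swap (oddLetter i) (evenLetter i)).prod (oddLetter i) =
        (if i ∈ l then evenLetter i else oddLetter i) ∧
      (l.map fun i => swap (oddLetter i) (evenLetter i)).prod (evenLetter i) =
        if i ∈ l then oddLetter i else evenLetter i := by
  induction l with
  | nil => simp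
  | cons j l ih =>
    obtain ⟨hj, hl⟩ := List.nodup_cons.1 hl
    obtain ⟨h1, h2⟩ := ih hl
    rw [List.map_cons, List.prod_cons, Perm.mul_apply, Perm.mul_apply, h1, h2]
    by_cases hij : i = j
    · subst hij
      simp [hj]
    · have e1 : swap (oddLetter j) (evenLetter j) (oddLetter i) = oddLetter i :=
        swap_apply_of_ne_of_ne (oddLetter_injective.ne hij) (oddLetter_ne_evenLetter _ _)
      have e2 : swap (oddLetter j) (evenLetter j) (evenLetter i) = evenLetter i :=
        swap_apply_of_ne_of_ne (oddLetter_ne_evenLetter _ _).symm (evenLetter_injective.ne hij)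
      by_cases hi : i ∈ l <;> simp [hi, hij, e1, e2]

theorem pairFlip_oddLetter (i : Fin n) : pairFlip n (oddLetter i) = evenLetter i := by
  have := (prod_swap_letters_apply (List.finRange n) (List.nodup_finRange n) i).1
  rwa [if_pos (List.mem_finRange i), ← List.ofFn_eq_map] at this

theorem pairFlip_evenLetter (i : Fin n) : pairFlip n (evenLetter i) = oddLetter i := by
  have := (prod_swap_letters_apply (List.finRange n) (List.nodup_finRange n) i).2
  rwa [if_pos (List.mem_finRange i), ← List.ofFn_eq_map] at this

variable (n) in
theorem isPairing_pairFlip : IsPairing (pairFlip n) where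
  apply_apply x := by
    obtain ⟨i, rfl | rfl⟩ := exists_eq_letter x <;> simp [pairFlip_oddLetter, pairFlip_evenLetter]
  apply_ne x := by
    obtain ⟨i, rfl | rfl⟩ := exists_eq_letter x
    · rw [pairFlip_oddLetter]; exact (oddLetter_ne_evenLetter _ _).symm
    · rw [pairFlip_evenLetter]; exact oddLetter_ne_evenLetter _ _

/-- The pairing of the letters with pairs `{σ(2i-1), σ(2i)}`. -/
def cosetPairing (σ : Perm (Fin (2 * n))) : Perm (Fin (2 * n)) := σ * pairFlip n * σ⁻¹

/-- The product of the two pairings whose pairs are the edges of `Γ(σ)`. -/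
def cosetPerm (σ : Perm (Fin (2 * n))) : Perm (Fin (2 * n)) := cosetPairing σ * pairFlip n

theorem isPairing_cosetPairing (σ : Perm (Fin (2 * n))) : IsPairing (cosetPairing σ) :=
  (isPairing_pairFlip n).conj σ

theorem mem_hyperoctahedral_iff (σ : Perm (Fin (2 * n))) :
    σ ∈ hyperoctahedral n ↔ cosetPairing σ = pairFlip n := by
  rw [hyperoctahedral, Subgroup.mem_centralizer_singleton_iff, cosetPairing,
    mul_inv_eq_iff_eq_mul]

theorem mem_hyperoctahedral_iff_cosetPerm (σ : Perm (Fin (2 * n))) :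
    σ ∈ hyperoctahedral n ↔ cosetPerm σ = 1 := by
  rw [mem_hyperoctahedral_iff, cosetPerm, mul_eq_one_iff_eq_inv, (isPairing_pairFlip n).inv_eq]

theorem cosetGraph_adj (σ : Perm (Fin (2 * n))) (x y : Fin (2 * n)) :
    (cosetGraph σ).Adj x y ↔ y = pairFlip n x ∨ y = cosetPairing σ x := by
  have hrange : ∀ x y : Fin (2 * n),
      (∃ i : Fin n, s(oddLetter i, evenLetter i) = s(x, y)) ↔ y = pairFlip n x := by
    intro x y
    constructor
    · rintro ⟨i, hi⟩
      rcases Sym2.eq_iff.1 hi with ⟨rfl, rfl⟩ | ⟨rfl, rfl⟩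
      · rw [pairFlip_oddLetter]
      · rw [pairFlip_evenLetter]
    · rintro rfl
      obtain ⟨i, rfl | rfl⟩ := exists_eq_letter x
      · exact ⟨i, by rw [pairFlip_oddLetter]⟩
      · exact ⟨i, by rw [pairFlip_evenLetter, Sym2.eq_swap]⟩
  have hrange' : (∃ i : Fin n, s(σ (oddLetter i), σ (evenLetter i)) = s(x, y)) ↔
      y = cosetPairing σ x := by
    have : ∀ i : Fin n, s(σ (oddLetter i), σ (evenLetter i)) = s(x, y) ↔
        s(oddLetter i, evenLetter i) = s(σ⁻¹ x, σ⁻¹ y) := by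
      intro i
      rw [Sym2.eq_iff, Sym2.eq_iff]
      simp only [Perm.eq_inv_iff_eq]
    simp only [this, hrange]
    rw [Perm.inv_eq_iff_eq]
    rfl
  rw [cosetGraph, SimpleGraph.fromEdgeSet_adj, Set.mem_union, Set.mem_range, Set.mem_range,
    hrange, hrange']
  refine and_iff_left_of_imp ?_
  rintro (rfl | rfl)
  · exact ((isPairing_pairFlip n).apply_ne x).symm
  · exact ((isPairing_cosetPairing σ).apply_ne x).symm

/-- The coset-type of `σ` is the cycle type of `cosetPerm σ` on a half of the letters. -/
theorem reduction_cosetType {σ : Perm (Fin (2 * n))} {A : Finset (Fin (2 * n))}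
    (h : IsHalf (pairFlip n) (cosetPerm σ) A) :
    reduction (cosetType σ) = reducedCycleType (restrictPerm h.apply_mem) := by
  classical
  have hc := reduction_ncard_components (isPairing_cosetPairing σ) (isPairing_pairFlip n) h _
    (cosetGraph_adj σ)
  rw [cosetType]
  convert hc
  rfl

theorem exists_isHalf_cosetPerm_mem (σ : Perm (Fin (2 * n))) (b : Fin (2 * n)) :
    ∃ A, IsHalf (pairFlip n) (cosetPerm σ) A ∧ b ∈ A :=
  exists_isHalf (isPairing_cosetPairing σ) (isPairing_pairFlip n) b

theorem exists_isHalf_cosetPerm (σ : Perm (Fin (2 * n))) :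
    ∃ A, IsHalf (pairFlip n) (cosetPerm σ) A := by
  rcases isEmpty_or_nonempty (Fin (2 * n)) with _ | ⟨⟨b⟩⟩
  · exact ⟨∅, isEmptyElim, isEmptyElim⟩
  · obtain ⟨A, hA, _⟩ := exists_isHalf_cosetPerm_mem σ b
    exact ⟨A, hA⟩

theorem rank_cosetPerm (σ : Perm (Fin (2 * n))) :
    (reducedCycleType (cosetPerm σ)).sum = 2 * (reduction (cosetType σ)).sum := by
  obtain ⟨A, hA⟩ := exists_isHalf_cosetPerm σ
  rw [reduction_cosetType hA]
  exact hA.rank_eq (isPairing_cosetPairing σ) (isPairing_pairFlip n)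

theorem cosetPerm_mul (g σ : Perm (Fin (2 * n))) :
    cosetPerm (g * σ) = g * cosetPerm σ * (pairFlip n * g⁻¹ * pairFlip n) := by
  simp only [cosetPerm, cosetPairing, mul_inv_rev, mul_assoc]
  rw [← mul_assoc (pairFlip n) (pairFlip n), (isPairing_pairFlip n).mul_self, one_mul]

theorem cosetPerm_swap_mul_apply (σ : Perm (Fin (2 * n))) {a b x : Fin (2 * n)}
    (ha : pairFlip n x ≠ a) (hb : pairFlip n x ≠ b) :
    cosetPerm (swap a b * σ) x = swap a b (cosetPerm σ x) := by
  rw [cosetPerm_mul, swap_inv]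
  simp only [Perm.mul_apply]
  rw [swap_apply_of_ne_of_ne ha hb, (isPairing_pairFlip n).apply_apply]

/-- A transposition of two letters of a half acts there by left multiplication. -/
theorem reduction_cosetType_swap_mul {σ : Perm (Fin (2 * n))} {A : Finset (Fin (2 * n))}
    (h : IsHalf (pairFlip n) (cosetPerm σ) A) {a b : Fin (2 * n)} (ha : a ∈ A) (hb : b ∈ A) :
    reduction (cosetType (swap a b * σ)) =
      reducedCycleType (swap a b * restrictPerm h.apply_mem) := by
  have ht := isPairing_pairFlip n
  have h' : IsHalf (pairFlip n) (cosetPerm (swap a b * σ)) A := by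
    refine ⟨fun x => ?_, h.flip_mem⟩
    rw [cosetPerm_mul, swap_inv]
    simp only [Perm.mul_apply]
    rw [swap_mem_iff ha hb, h.apply_mem, h.flip_mem, swap_mem_iff ha hb, h.flip_mem, not_not]
  rw [reduction_cosetType h']
  congr 1
  ext x : 1
  by_cases hx : x ∈ A
  · have hx' : pairFlip n x ∉ A := by rw [h.flip_mem]; exact not_not.2 hx
    rw [restrictPerm_of_mem _ hx, Perm.mul_apply, restrictPerm_of_mem _ hx,
      cosetPerm_swap_mul_apply]
    · rintro rfl; exact hx' ha
    · rintro rfl; exact hx' hb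
  · rw [restrictPerm_of_notMem _ hx, Perm.mul_apply, restrictPerm_of_notMem _ hx,
      swap_apply_of_ne_of_ne]
    · rintro rfl; exact hx ha
    · rintro rfl; exact hx hb

theorem evenLetter_fixed {σ : Perm (Fin (2 * n))} {j : Fin n}
    (h : cosetPerm σ (oddLetter j) = oddLetter j) :
    cosetPerm σ (evenLetter j) = evenLetter j := by
  simp only [cosetPerm, Perm.mul_apply, pairFlip_oddLetter, pairFlip_evenLetter] at h ⊢
  exact ((isPairing_cosetPairing σ).apply_eq_iff.1 h).symm

open scoped Classical in
/-- The orthogonal case: `P_n` is moved by `J₁, J₃, …, J_{2n-1}`, and the cycles of the product of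
the two pairings attached to a permutation are cut and joined. -/
noncomputable def orthogonalModel (n : ℕ) : JucysMurphyModel (2 * n) n where
  letter := oddLetter
  base := {ζ : Perm (Fin (2 * n)) | ζ ∈ hyperoctahedral n}
  assoc := cosetPerm
  type σ := reduction (cosetType σ)
  letter_strictMono := by
    intro i j h
    have : (i : ℕ) < j := h
    change 2 * (i : ℕ) < 2 * (j : ℕ)
    omega
  assoc_swap_mul_apply σ i j a hij ha := by
    have h1 : (i : ℕ) ≤ j := hij
    have h2 : (a : ℕ) < 2 * i := ha
    apply cosetPerm_swap_mul_apply <;> rw [pairFlip_oddLetter]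
    · intro h
      have := congrArg Fin.val h
      simp only [evenLetter] at this
      omega
    · exact (oddLetter_ne_evenLetter _ _).symm
  le_of_sameCycle σ i a hfix hs := by
    obtain ⟨j, hj⟩ := exists_eq_letter a
    rcases lt_trichotomy i j with hij | rfl | hij
    · have hfa : cosetPerm σ a = a := by
        rcases hj with rfl | rfl
        · exact hfix j hij
        · exact evenLetter_fixed (hfix j hij)
      exact (hs.eq_of_right hfa).ge
    · rcases hj with rfl | rfl
      · exact le_rfl
      · rw [← pairFlip_oddLetter] at hs
        exact absurd hs ((isPairing_cosetPairing σ).not_sameCycle (isPairing_pairFlip n) _)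
    · have h1 : (j : ℕ) < i := hij
      rw [Fin.le_def]
      rcases hj with rfl | rfl <;> simp only [oddLetter, evenLetter] <;> omega
  rank_of_sameCycle σ i a hne hs := by
    obtain ⟨A, hA, hb⟩ := exists_isHalf_cosetPerm_mem σ (oddLetter i)
    rw [reduction_cosetType_swap_mul hA (hA.mem_of_sameCycle hb hs) hb, reduction_cosetType hA]
    exact rank_swap_mul_of_sameCycle hne ((sameCycle_restrictPerm _ hb).2 hs)
  rank_of_not_sameCycle σ i a hs := by
    -- The first of the two transpositions joins two cycles, the second can at most undo this.
    have h1 := rank_cosetPerm σ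
    have h2 := rank_cosetPerm (swap a (oddLetter i) * σ)
    have h3 := rank_swap_mul_of_not_sameCycle hs
    have ht := isPairing_pairFlip n
    have h4 : cosetPerm (swap a (oddLetter i) * σ) =
        swap ((swap a (oddLetter i) * cosetPerm σ) (pairFlip n a))
          ((swap a (oddLetter i) * cosetPerm σ) (pairFlip n (oddLetter i))) *
          (swap a (oddLetter i) * cosetPerm σ) := by
      rw [← mul_swap_eq_swap_mul, cosetPerm_mul, swap_inv]
      congr 1
      rw [mul_swap_eq_swap_mul, mul_assoc, ht.mul_self, mul_one]
    have h5 := rank_le_rank_swap_mul_add_one (swap a (oddLetter i) * cosetPerm σ)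
      ((swap a (oddLetter i) * cosetPerm σ) (pairFlip n a))
      ((swap a (oddLetter i) * cosetPerm σ) (pairFlip n (oddLetter i)))
    rw [← h4] at h5
    omega
  weight_eq σ i hne := by
    obtain ⟨A, hA, hb⟩ := exists_isHalf_cosetPerm_mem σ (oddLetter i)
    have hne' : restrictPerm hA.apply_mem (oddLetter i) ≠ oddLetter i := by
      rwa [restrictPerm_of_mem _ hb]
    rw [reduction_cosetType hA, catalanWeight_eq_sum_swap_mul hne']
    simp only [sameCycle_restrictPerm hA.apply_mem hb]
    refine Finset.sum_congr (by ext; simp) fun a ha => ?_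
    have hs := (Finset.mem_filter.1 ha).2.2
    rw [reduction_cosetType_swap_mul hA (hA.mem_of_sameCycle hb hs) hb]
  mem_base_iff σ := by
    rw [Finset.mem_filter, mem_hyperoctahedral_iff_cosetPerm]
    simp only [Finset.mem_univ, true_and]
    refine ⟨fun h j => by rw [h]; rfl, fun h => ?_⟩
    ext x : 1
    obtain ⟨j, rfl | rfl⟩ := exists_eq_letter x
    · exact h j
    · exact evenLetter_fixed (h j)
  type_of_mem_base σ h := by
    have h1 := (mem_hyperoctahedral_iff_cosetPerm σ).1 (Finset.mem_filter.1 h).2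
    obtain ⟨A, hA⟩ := exists_isHalf_cosetPerm σ
    have h2 : restrictPerm hA.apply_mem = 1 := by
      ext x : 1
      by_cases hx : x ∈ A
      · rw [restrictPerm_of_mem _ hx, h1]
      · rw [restrictPerm_of_notMem _ hx]; rfl
    rw [reduction_cosetType hA, h2]
    simp [reducedCycleType]

/-- Permutations with the same reduced coset-type lie in the same double coset of the
hyperoctahedral group. -/
theorem exists_mul_mem_of_reduction_cosetType_eq {σ τ : Perm (Fin (2 * n))}
    (h : reduction (cosetType σ) = reduction (cosetType τ)) :
    ∃ g ∈ hyperoctahedral n, ∃ g' ∈ hyperoctahedral n, τ = g * σ * g' := by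
  obtain ⟨A, hA⟩ := exists_isHalf_cosetPerm σ
  obtain ⟨B, hB⟩ := exists_isHalf_cosetPerm τ
  rw [reduction_cosetType hA, reduction_cosetType hB] at h
  obtain ⟨g, hgt, hgs⟩ := exists_commute_conj_eq (isPairing_cosetPairing σ)
    (isPairing_cosetPairing τ) (isPairing_pairFlip n) hA hB (cycleType_eq_of_reducedCycleType_eq h)
  refine ⟨g, Subgroup.mem_centralizer_singleton_iff.2 hgt,
    σ⁻¹ * g⁻¹ * τ, ?_, by group⟩
  rw [mem_hyperoctahedral_iff]
  have h1 : cosetPairing τ = g * cosetPairing σ * g⁻¹ := by rw [hgs, mul_inv_cancel_right]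
  have h2 : cosetPairing (σ⁻¹ * g⁻¹ * τ) = σ⁻¹ * g⁻¹ * cosetPairing τ * g * σ := by
    simp [cosetPairing, mul_assoc]
  rw [h2, h1]
  simp [cosetPairing, mul_assoc]

theorem reduction_cosetType_mul {g : Perm (Fin (2 * n))} (hg : g ∈ hyperoctahedral n)
    (σ : Perm (Fin (2 * n))) :
    (reduction (cosetType (g * σ))).sum = (reduction (cosetType σ)).sum := by
  have h1 := rank_cosetPerm σ
  have h2 := rank_cosetPerm (g * σ)
  have hg' := (mem_hyperoctahedral_iff _).1 (inv_mem hg)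
  have h3 : cosetPerm (g * σ) = g * cosetPerm σ * g⁻¹ := by
    rw [cosetPerm_mul]
    congr 1
    have h4 : g⁻¹ * pairFlip n = pairFlip n * g⁻¹ := by
      rw [← mul_inv_eq_iff_eq_mul]
      exact hg'
    rw [mul_assoc, h4, ← mul_assoc, (isPairing_pairFlip n).mul_self, one_mul]
  rw [h3, reducedCycleType, cycleType_conj, ← reducedCycleType] at h2
  omega

/-- The odd letters. -/
def oddLetters (n : ℕ) : Finset (Fin (2 * n)) := Finset.univ.map ⟨oddLetter, oddLetter_injective⟩

theorem oddLetter_mem (i : Fin n) : oddLetter i ∈ oddLetters n := by simp [oddLetters]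

theorem evenLetter_notMem (i : Fin n) : evenLetter i ∉ oddLetters n := by
  simp [oddLetters, oddLetter_ne_evenLetter]

/-- Every permutation of `n` letters, put on the odd letters, has its cycle type as coset-type. -/
theorem exists_reduction_cosetType_eq (π : Perm (Fin n)) :
    ∃ σ : Perm (Fin (2 * n)), reduction (cosetType σ) = reducedCycleType π := by
  let e : Fin n ≃ {x // x ∈ oddLetters n} := Equiv.ofBijective
    (fun i => ⟨oddLetter i, oddLetter_mem i⟩)
    ⟨fun i j h => oddLetter_injective (congrArg Subtype.val h), by
      rintro ⟨x, hx⟩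
      obtain ⟨i, -, rfl⟩ := Finset.mem_map.1 hx
      exact ⟨i, rfl⟩⟩
  have hodd : ∀ (π : Perm (Fin n)) i, π.extendDomain e (oddLetter i) = oddLetter (π i) :=
    fun π i => π.extendDomain_apply_image e i
  have heven : ∀ (π : Perm (Fin n)) i, π.extendDomain e (evenLetter i) = evenLetter i :=
    fun π i => π.extendDomain_apply_not_subtype e (evenLetter_notMem i)
  have hinv : (π.extendDomain e)⁻¹ = π⁻¹.extendDomain e := (extendDomain_inv _ _)
  have h1 : ∀ i, cosetPerm (π.extendDomain e) (oddLetter i) = oddLetter (π i) := by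
    intro i
    rw [cosetPerm, cosetPairing, hinv]
    simp only [Perm.mul_apply, pairFlip_oddLetter, pairFlip_evenLetter, heven, hodd]
  have h2 : ∀ i, cosetPerm (π.extendDomain e) (evenLetter i) = evenLetter (π⁻¹ i) := by
    intro i
    rw [cosetPerm, cosetPairing, hinv]
    simp only [Perm.mul_apply, pairFlip_oddLetter, pairFlip_evenLetter, heven, hodd]
  have hA : IsHalf (pairFlip n) (cosetPerm (π.extendDomain e)) (oddLetters n) := by
    constructor
    · intro x
      obtain ⟨i, rfl | rfl⟩ := exists_eq_letter x
      · rw [h1]; exact iff_of_true (oddLetter_mem _) (oddLetter_mem _)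
      · rw [h2]; exact iff_of_false (evenLetter_notMem _) (evenLetter_notMem _)
    · intro x
      obtain ⟨i, rfl | rfl⟩ := exists_eq_letter x
      · rw [pairFlip_oddLetter]
        exact iff_of_false (evenLetter_notMem _) (not_not.2 (oddLetter_mem _))
      · rw [pairFlip_evenLetter]
        exact iff_of_true (oddLetter_mem _) (evenLetter_notMem _)
  refine ⟨π.extendDomain e, ?_⟩
  have h3 : restrictPerm hA.apply_mem = π.extendDomain e := by
    ext x : 1
    obtain ⟨i, rfl | rfl⟩ := exists_eq_letter x
    · rw [restrictPerm_of_mem _ (oddLetter_mem i), h1, hodd]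
    · rw [restrictPerm_of_notMem _ (evenLetter_notMem i), heven]
  rw [reduction_cosetType hA, h3, reducedCycleType, cycleType_extendDomain, reducedCycleType]

end Hyperoctahedral

/-! ### Expansions indexed by reduced partitions -/

section Expansion

theorem sum_add_card_reducedCycleType {α : Type*} [Fintype α] [DecidableEq α] (f : Perm α) :
    (reducedCycleType f).sum + Multiset.card (reducedCycleType f) = f.support.card := by
  rw [← sum_cycleType, ← map_succ_reducedCycleType, Multiset.sum_map_add]
  simp

theorem pos_of_mem_reducedCycleType {α : Type*} [Fintype α] [DecidableEq α] {f : Perm α} {a : ℕ}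
    (h : a ∈ reducedCycleType f) : 0 < a := by
  obtain ⟨m, hm, rfl⟩ := Multiset.mem_map.1 h
  have := two_le_of_mem_cycleType hm
  omega

theorem exists_reducedCycleType_eq {n : ℕ} {s : Multiset ℕ} (hpos : ∀ a ∈ s, 0 < a)
    (hs : s.sum + Multiset.card s ≤ n) : ∃ π : Perm (Fin n), reducedCycleType π = s := by
  have h : ∃ π : Perm (Fin n), π.cycleType = s.map fun a => a + 1 := by
    rw [exists_with_cycleType_iff]
    constructor
    · rw [Multiset.sum_map_add]
      simpa using hs
    · intro a ha
      obtain ⟨b, hb, rfl⟩ := Multiset.mem_map.1 ha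
      have := hpos b hb
      omega
  obtain ⟨π, hπ⟩ := h
  refine ⟨π, ?_⟩
  rw [reducedCycleType, hπ, Multiset.map_map]
  simp

theorem reduction_partition {n : ℕ} (σ : Perm (Fin n)) :
    reduction σ.partition.parts = reducedCycleType σ := by
  rw [reduction, parts_partition, Multiset.map_add, Multiset.filter_add, Multiset.map_replicate]
  have h1 : (Multiset.replicate (Fintype.card (Fin n) - σ.support.card) (1 - 1)).filter
      (fun a => a ≠ 0) = 0 := by
    rw [Multiset.filter_eq_nil]
    intro a ha
    simp [Multiset.eq_of_mem_replicate ha]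
  rw [h1, add_zero, Multiset.filter_eq_self.2]
  · rfl
  · intro a ha
    exact (pos_of_mem_reducedCycleType ha).ne'

theorem ReducedPartition.ext {n : ℕ} {ν ν' : ReducedPartition n}
    (h : ν.1.2.parts = ν'.1.2.parts) : ν = ν' := by
  obtain ⟨⟨m, p⟩, hν⟩ := ν
  obtain ⟨⟨m', p'⟩, hν'⟩ := ν'
  have hm : m = m' := by
    have h' := congrArg Multiset.sum h
    rwa [p.parts_sum, p'.parts_sum] at h'
  subst hm
  have hp : p = p' := Nat.Partition.ext h
  subst hp
  rfl

variable {N n : ℕ} {T : Perm (Fin N) → Multiset ℕ}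

/-- The sum over all reduced partitions picks out the one which is the type of the permutation. -/
theorem coeff_sum_smul_permSum [DecidableEq (Multiset ℕ)] (F : ReducedPartition n → ℂ)
    {σ : Perm (Fin N)} {ν : ReducedPartition n} (hν : T σ = ν.1.2.parts) :
    (∑ ν, F ν • permSum {σ : Perm (Fin N) | T σ = ν.1.2.parts} : SymGroupAlg N).coeff σ = F ν := by
  rw [MonoidAlgebra.coeff_sum, Finsupp.finsetSum_apply, Finset.sum_eq_single ν]
  · rw [MonoidAlgebra.coeff_smul_apply, coeff_permSum, if_pos (by simpa using hν)]
    simp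
  · intro ν' _ hne
    rw [MonoidAlgebra.coeff_smul_apply, coeff_permSum, if_neg, smul_zero]
    intro h
    exact hne (ReducedPartition.ext (by rw [← hν, (Finset.mem_filter.1 h).2]))
  · simp

theorem exists_reducedPartition {s : Multiset ℕ} (hpos : ∀ a ∈ s, 0 < a)
    (hs : s.sum + Multiset.card s ≤ n) : ∃ ν : ReducedPartition n, s = ν.1.2.parts :=
  ⟨⟨⟨s.sum, ⟨s, fun {a} h => hpos a h, rfl⟩⟩, hs⟩, rfl⟩

/-- If the types are exactly the reduced partitions, then an element of the group algebra whose
coefficients depend on the type only has a unique expansion in the sums over the types. -/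
theorem existsUnique_coeff [DecidableEq (Multiset ℕ)]
    (hT : ∀ σ, ∃ ν : ReducedPartition n, T σ = ν.1.2.parts)
    (hsurj : ∀ ν : ReducedPartition n, ∃ σ, T σ = ν.1.2.parts) {y : SymGroupAlg N}
    (hy : ∀ σ τ, T σ = T τ → y.coeff σ = y.coeff τ) :
    ∃! F : ReducedPartition n → ℂ,
      y = ∑ ν, F ν • permSum {σ : Perm (Fin N) | T σ = ν.1.2.parts} := by
  choose rep hrep using hsurj
  refine ⟨fun ν => y.coeff (rep ν), symGroupAlg_ext fun σ => ?_, ?_⟩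
  · obtain ⟨ν, hν⟩ := hT σ
    rw [coeff_sum_smul_permSum _ hν]
    exact hy _ _ (by rw [hrep, hν])
  · intro F hF
    funext ν
    rw [hF, coeff_sum_smul_permSum F (hrep ν)]

end Expansion

/-! ### Invariance of the complete symmetric polynomials -/

section Invariance

theorem hyperoctahedralSum_eq (n : ℕ) :
    hyperoctahedralSum n = permSum (orthogonalModel n).base := rfl

theorem permSum_one {n : ℕ} : permSum ({1} : Finset (Perm (Fin n))) = 1 := by
  simp [permSum, MonoidAlgebra.one_def]

/-- `h_k(J₁, …, J_n)` commutes with all permutations, since the elementary symmetric polynomials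
do: their coefficients depend on the rank only. -/
theorem single_mul_hComplete_eq {n k : ℕ} (g : Perm (Fin n)) :
    MonoidAlgebra.single g 1 * hComplete k (fun i : Fin n => jucysMurphy i) =
      hComplete k (fun i : Fin n => jucysMurphy i) * MonoidAlgebra.single g 1 := by
  classical
  let M := unitaryModel n
  let I : Submodule ℂ (SymGroupAlg n) :=
    { carrier := {y | ∀ g, MonoidAlgebra.single g 1 * y = y * MonoidAlgebra.single g 1}
      add_mem' := fun ha hb g => by rw [mul_add, add_mul, ha g, hb g]
      zero_mem' := fun g => by rw [mul_zero, zero_mul]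
      smul_mem' := fun c y hy g => by rw [mul_smul_comm, smul_mul_assoc, hy g] }
  have hE : ∀ i, elemSymm M.element n i ∈ I := by
    intro i g
    refine symGroupAlg_ext fun σ => ?_
    have hcoeff : ∀ σ, (elemSymm M.element n i).coeff σ =
        if M.Level n σ ∧ (M.type σ).sum = i then 1 else 0 := by
      intro σ
      rw [← M.coeff_elemSymm_mul le_rfl]
      change _ = (_ * permSum {1}).coeff σ
      rw [permSum_one, mul_one]
    rw [coeff_single_mul_perm, coeff_mul_single_perm, hcoeff, hcoeff]
    have : M.type (g⁻¹ * σ) = M.type (σ * g⁻¹) := by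
      change reducedCycleType (g⁻¹ * σ) = reducedCycleType (σ * g⁻¹)
      rw [reducedCycleType, reducedCycleType, ← cycleType_conj (σ := g⁻¹ * σ) (τ := g)]
      congr 2
      group
    simp [JucysMurphyModel.level_top, this]
  have h := completeSymm_mul_mem M.element_commute n I (v := 1) (fun g => by simp) (fun i y hy g =>
    by rw [← mul_assoc, hE i g, mul_assoc, hy g, mul_assoc]) k
  rw [mul_one, M.completeSymm_element] at h
  exact h g

theorem coeff_hComplete_unitary_eq {n k : ℕ} {σ τ : Perm (Fin n)}
    (h : reducedCycleType σ = reducedCycleType τ) :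
    (hComplete k (fun i : Fin n => jucysMurphy i)).coeff σ =
      (hComplete k (fun i : Fin n => jucysMurphy i)).coeff τ := by
  obtain ⟨g, rfl⟩ := isConj_iff.1 (isConj_of_cycleType_eq (cycleType_eq_of_reducedCycleType_eq h))
  have h1 := congrArg (fun y => y.coeff (g * σ)) (single_mul_hComplete_eq (k := k) g)
  simpa [coeff_single_mul_perm, coeff_mul_single_perm] using h1

open scoped Classical in
theorem permSum_subgroup_mul {N : ℕ} (H : Subgroup (Perm (Fin N))) {y : SymGroupAlg N}
    (hy : ∀ g ∈ H, MonoidAlgebra.single g 1 * y = y) :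
    permSum {g : Perm (Fin N) | g ∈ H} * y = (Nat.card H : ℂ) • y := by
  rw [permSum, Finset.sum_mul, Finset.sum_congr rfl fun g hg => hy g (by simpa using hg),
    Finset.sum_const, ← Nat.cast_smul_eq_nsmul ℂ]
  congr 2
  rw [Nat.card_eq_fintype_card, Fintype.card_subtype]

theorem hyperoctahedralSum_mul_single {n : ℕ} {g : Perm (Fin (2 * n))}
    (hg : g ∈ hyperoctahedral n) :
    hyperoctahedralSum n * MonoidAlgebra.single g 1 = hyperoctahedralSum n := by
  refine symGroupAlg_ext fun σ => ?_
  rw [coeff_mul_single_perm, hyperoctahedralSum, coeff_permSum, coeff_permSum]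
  refine if_congr ?_ rfl rfl
  simp [Subgroup.mul_mem_cancel_right _ (inv_mem hg)]

theorem single_mul_hyperoctahedralSum {n : ℕ} {g : Perm (Fin (2 * n))}
    (hg : g ∈ hyperoctahedral n) :
    MonoidAlgebra.single g 1 * hyperoctahedralSum n = hyperoctahedralSum n := by
  refine symGroupAlg_ext fun σ => ?_
  rw [coeff_single_mul_perm, hyperoctahedralSum, coeff_permSum, coeff_permSum]
  refine if_congr ?_ rfl rfl
  simp [Subgroup.mul_mem_cancel_left _ (inv_mem hg)]

/-- `h_k(J₁, J₃, …, J_{2n-1}) P_n` is invariant under `H_n` from the left. The elements `e_i P_n`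
are, since their coefficients depend on the rank only, and if `y` is left invariant, then so is
`e_i y = |H_n|⁻¹ (e_i P_n) y`. -/
theorem single_mul_hComplete_mul {n k : ℕ} {g : Perm (Fin (2 * n))}
    (hg : g ∈ hyperoctahedral n) :
    MonoidAlgebra.single g 1 *
        (hComplete k (fun i : Fin n => jucysMurphy (oddLetter i)) * hyperoctahedralSum n) =
      hComplete k (fun i : Fin n => jucysMurphy (oddLetter i)) * hyperoctahedralSum n := by
  classical
  let M := orthogonalModel n
  let I : Submodule ℂ (SymGroupAlg (2 * n)) :=
    { carrier := {y | ∀ g ∈ hyperoctahedral n, MonoidAlgebra.single g 1 * y = y}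
      add_mem' := fun ha hb g hg => by rw [mul_add, ha g hg, hb g hg]
      zero_mem' := fun g _ => by rw [mul_zero]
      smul_mem' := fun c y hy g hg => by rw [mul_smul_comm, hy g hg] }
  have hEP : ∀ i, elemSymm M.element n i * hyperoctahedralSum n ∈ I := by
    intro i g hg
    refine symGroupAlg_ext fun σ => ?_
    rw [coeff_single_mul_perm, hyperoctahedralSum_eq, M.coeff_elemSymm_mul le_rfl,
      M.coeff_elemSymm_mul le_rfl]
    have : (M.type (g⁻¹ * σ)).sum = (M.type σ).sum := reduction_cosetType_mul (inv_mem hg) σ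
    simp [JucysMurphyModel.level_top, this]
  have hE : ∀ i, ∀ y ∈ I, elemSymm M.element n i * y ∈ I := by
    intro i y hy
    have hP : hyperoctahedralSum n * y = (Nat.card (hyperoctahedral n) : ℂ) • y :=
      permSum_subgroup_mul _ hy
    have hc : (Nat.card (hyperoctahedral n) : ℂ) ≠ 0 := Nat.cast_ne_zero.2 Nat.card_pos.ne'
    have hy' : y = (Nat.card (hyperoctahedral n) : ℂ)⁻¹ • (hyperoctahedralSum n * y) := by
      rw [hP, smul_smul, inv_mul_cancel₀ hc, one_smul]
    rw [hy', mul_smul_comm, ← mul_assoc]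
    refine I.smul_mem _ fun g hg => ?_
    rw [← mul_assoc, hEP i g hg]
  have h := completeSymm_mul_mem M.element_commute n I
    (fun g hg => single_mul_hyperoctahedralSum hg) hE k
  rw [M.completeSymm_element] at h
  exact h g hg

theorem coeff_hComplete_orthogonal_eq {n k : ℕ} {σ τ : Perm (Fin (2 * n))}
    (h : reduction (cosetType σ) = reduction (cosetType τ)) :
    (hComplete k (fun i : Fin n => jucysMurphy (oddLetter i)) * hyperoctahedralSum n).coeff σ =
      (hComplete k (fun i : Fin n => jucysMurphy (oddLetter i)) * hyperoctahedralSum n).coeff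
        τ := by
  obtain ⟨g, hg, g', hg', rfl⟩ := exists_mul_mem_of_reduction_cosetType_eq h
  have h1 := congrArg (fun y => y.coeff (g * σ)) (single_mul_hComplete_mul (k := k) hg)
  simp only [coeff_single_mul_perm, inv_mul_cancel_left] at h1
  have h2 := congrArg (fun y => (hComplete k (fun i : Fin n => jucysMurphy (oddLetter i)) *
    y).coeff (g * σ * g')) (hyperoctahedralSum_mul_single hg')
  simp only [← mul_assoc _ (hyperoctahedralSum n), coeff_mul_single_perm,
    mul_inv_cancel_right] at h2
  rw [h1, h2]

end Invariance

/-! ### The coefficients -/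

theorem exists_reducedPartition_reducedCycleType {n : ℕ} (σ : Perm (Fin n)) :
    ∃ ν : ReducedPartition n, reducedCycleType σ = ν.1.2.parts :=
  exists_reducedPartition (fun _ => pos_of_mem_reducedCycleType) (by
    rw [sum_add_card_reducedCycleType]
    exact (Finset.card_le_univ _).trans (by simp))

theorem exists_reducedPartition_cosetType {n : ℕ} (σ : Perm (Fin (2 * n))) :
    ∃ ν : ReducedPartition n, reduction (cosetType σ) = ν.1.2.parts := by
  obtain ⟨A, hA⟩ := exists_isHalf_cosetPerm σ
  rw [reduction_cosetType hA]
  refine exists_reducedPartition (fun _ => pos_of_mem_reducedCycleType) ?_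
  rw [sum_add_card_reducedCycleType]
  have h1 : (restrictPerm hA.apply_mem).support ⊆ A := fun x hx =>
    mem_of_restrictPerm_ne _ (mem_support.1 hx)
  have h2 := hA.two_mul_card (isPairing_pairFlip n)
  rw [Fintype.card_fin] at h2
  have h3 := Finset.card_le_card h1
  omega

theorem exists_perm_of_reducedPartition {n : ℕ} (ν : ReducedPartition n) :
    ∃ π : Perm (Fin n), reducedCycleType π = ν.1.2.parts :=
  exists_reducedCycleType_eq (fun _ h => ν.1.2.parts_pos h) (by
    rw [ν.1.2.parts_sum]; exact ν.2)

theorem isUnitaryCoeff_iff {n k : ℕ} (F : ReducedPartition n → ℂ) :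
    IsUnitaryCoeff n k F ↔ hComplete k (fun i : Fin n => jucysMurphy i) =
      ∑ ν, F ν • permSum {σ : Perm (Fin n) | reducedCycleType σ = ν.1.2.parts} := by
  simp only [IsUnitaryCoeff, classSum, reduction_partition]

theorem mainTheorem2 (n k : ℕ) :
    (∃! F : ReducedPartition n → ℂ, IsUnitaryCoeff n k F) ∧
    (∃! G : ReducedPartition n → ℂ, IsOrthogonalCoeff n k G) ∧
    ∀ F G : ReducedPartition n → ℂ, IsUnitaryCoeff n k F → IsOrthogonalCoeff n k G →
      ∀ (μ : k.Partition) (hμ : k + μ.parts.card ≤ n),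
        G ⟨⟨k, μ⟩, hμ⟩ = F ⟨⟨k, μ⟩, hμ⟩ ∧
        G ⟨⟨k, μ⟩, hμ⟩ = ((μ.parts.map catalan).prod : ℕ) := by
  refine ⟨?_, ?_, fun F G hF hG μ hμ => ?_⟩
  · simp only [isUnitaryCoeff_iff]
    exact existsUnique_coeff exists_reducedPartition_reducedCycleType
      exists_perm_of_reducedPartition fun σ τ => coeff_hComplete_unitary_eq
  · refine existsUnique_coeff (T := fun σ => reduction (cosetType σ))
      exists_reducedPartition_cosetType (fun ν => ?_) fun σ τ => coeff_hComplete_orthogonal_eq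
    obtain ⟨π, hπ⟩ := exists_perm_of_reducedPartition ν
    obtain ⟨σ, hσ⟩ := exists_reduction_cosetType_eq π
    exact ⟨σ, hσ.trans hπ⟩
  · obtain ⟨π, hπ⟩ := exists_perm_of_reducedPartition (⟨⟨k, μ⟩, hμ⟩ : ReducedPartition n)
    obtain ⟨σ, hσ⟩ := exists_reduction_cosetType_eq π
    have hσ' := hσ.trans hπ
    have hFv : F ⟨⟨k, μ⟩, hμ⟩ = catalanWeight μ.parts := by
      rw [← coeff_sum_smul_permSum F hπ, ← (isUnitaryCoeff_iff F).1 hF]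
      have h := ((unitaryModel n).coeff_completeSymm_mul le_rfl k π).2
        (JucysMurphyModel.level_top π) (by
          change (reducedCycleType π).sum = k
          rw [hπ]; exact μ.parts_sum)
      rw [(unitaryModel n).completeSymm_element] at h
      change (_ * permSum {1}).coeff π = (catalanWeight (reducedCycleType π) : ℂ) at h
      rw [permSum_one, mul_one, hπ] at h
      exact h
    have hGv : G ⟨⟨k, μ⟩, hμ⟩ = catalanWeight μ.parts := by
      rw [← coeff_sum_smul_permSum (T := fun σ => reduction (cosetType σ)) G hσ']
      have h := ((orthogonalModel n).coeff_completeSymm_mul le_rfl k σ).2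
        (JucysMurphyModel.level_top σ) (by
          change (reduction (cosetType σ)).sum = k
          rw [hσ']; exact μ.parts_sum)
      rw [(orthogonalModel n).completeSymm_element, ← hyperoctahedralSum_eq] at h
      change _ = (catalanWeight (reduction (cosetType σ)) : ℂ) at h
      rw [hσ'] at h
      refine Eq.trans ?_ h
      exact congrArg (fun y => y.coeff σ) hG.symm
    exact ⟨hGv.trans hFv.symm, hGv⟩
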